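/- A rational-time subproduct system consists of two-dimensional complex Hilbert spaces $E_t$ ($t\in\mathbb Q_+=\mathbb Q\cap(0,\infty)$) and linear isometries $\beta_{s,t}:E_{s+t}\to E_s\otimes E_t$ that are associative: $(\beta_{r,s}\otimes 1_t)\beta_{r+s,t}=(1_r\otimes\beta_{s,t})\beta_{r,s+t}$ for all $r,s,t\in\mathbb Q_+$. An Arveson system consists of separable Hilbert spaces $\tilde E_t$ ($t\in(0,\infty)$) with unitaries $\tilde\beta_{s,t}:\tilde E_{s+t}\to\tilde E_s\otimes\tilde E_t$ onto the Hilbert space tensor products, associative, and Borel measurable with respect to a trivialization $\tilde E_t\cong H$ ($H\neq0$ separable). A unit is a measurable section $(u_t)_{t>0}$, not identically zero, with $\tilde\beta_{s,t}(u_{s+t})=u_s\otimes u_t$. The system is of type $I$ if it has a unit and, for each $t$, the products $u^1_{t_1}\cdots u^n_{t_n}$ of units with $t_1+\dots+t_n=t$ span a dense subspace of $\tilde E_t$; it is of type $I_1$ if moreover its index is $1$, i.e. there is a function $\gamma$ on pairs of units with $\langle u_t,v_t\rangle=e^{t\gamma(u,v)}$ for all $t>0$, and the Hilbert space obtained from the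 semi-inner product $\sum_{u,v}\gamma(u,v)\overline{f(u)}g(v)$ on the finitely supported functions $f,g$ of sum zero on the set of units has dimension $1$. A representation of $(E_t,\beta_{s,t})$ in $(\tilde E_t,\tilde\beta_{s,t})$ consists of linear isometries $\alpha_t:E_t\to\tilde E_t$ ($t\in\mathbb Q_+$) with $\tilde\beta_{s,t}\alpha_{s+t}=(\alpha_s\otimes\alpha_t)\beta_{s,t}$ for all $s,t\in\mathbb Q_+$. The symmetric Fock spaces $\tilde E_t=\bigoplus_{n\ge0}L_2(0,t)^{\otimes n}_{\mathrm{sym}}$, with the natural identification $\tilde E_{s+t}=\tilde E_s\otimes\tilde E_t$ coming from $L_2(0,s+t)=L_2(0,s)\oplus L_2(s,s+t)$ and translation by $s$ of $L_2(0,t)$ onto $L_2(s,s+t)$, and with the usual Borel structure, form an Arveson system of type $I_1$, and the following holds. (1) Let $(E_t,\beta_{s,t})$ be a rational-time subproduct system, $a\in(0,1)$, and $x_t,y_t\in E_t$ such that for all $s,t\in\mathbb Q_+$ $$\|x_t\|=\|y_t\|=1,\quad \langle x_t,y_t\rangle=a^t,\quad \beta_{s,t}(x_{s+t})=x_s\otimes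 x_t,\quad \beta_{s,t}(y_{s+t})=y_s\otimes y_t .$$ Then there are units $(u_t)_{t>0}$, $(v_t)_{t>0}$ of this Arveson system with $\|u_t\|=\|v_t\|=1$ and $\langle u_t,v_t\rangle=a^t$ for all real $t>0$, and a representation $(\alpha_t)$ of $(E_t,\beta_{s,t})$ in it with $\alpha_t(x_t)=u_t$ and $\alpha_t(y_t)=v_t$ for all $t\in\mathbb Q_+$. (3) Let $(E_t,\beta_{s,t})$ be a rational-time subproduct system, $c\in(0,\infty)$, $b\in\mathbb R$, and $x_t,y_t\in E_t$ such that for all $s,t\in\mathbb Q_+$ $$\|x_t\|=1,\quad \langle x_t,y_t\rangle=0,\quad \|y_t\|^2=\begin{cases}t&\text{if }c=1,\\(c^{2t}-1)/(c^2-1)&\text{if }c\ne1,\end{cases}$$ $$\beta_{s,t}(x_{s+t})=x_s\otimes x_t,\quad \beta_{s,t}(y_{s+t})=y_s\otimes x_t+c^se^{ibs}\,x_s\otimes y_t .$$ Then there is a representation $(\alpha_t)$ of $(E_t,\beta_{s,t})$ in this Arveson system such that, for all $t\in\mathbb Q_+$, $\alpha_t(x_t)$ is the vacuum vector $1\oplus0\oplus0\oplus\cdots$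 and $\alpha_t(y_t)$ is the one-particle vector $0\oplus f_t\oplus0\oplus\cdots$ with $f_t(s)=Ac^se^{ibs}$ for $s\in(0,t)$, where $A=1$ if $c=1$ and $A=\sqrt{2\ln c/(c^2-1)}$ if $c\neq1$. -/

import Mathlib

open MeasureTheory
open scoped TensorProduct ENNReal ComplexConjugate

universe w

noncomputable section

/-- Positive rational times. -/
abbrev PosRat : Type := {t : ℚ // 0 < t}

/-- Positive real times. -/
abbrev PosReal : Type := {t : ℝ // 0 < t}

/-- A positive rational time seen as a positive real time. -/
def PosRat.toReal (t : PosRat) : PosReal := ⟨((t : ℚ) : ℝ), by exact_mod_cast t.2⟩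

theorem PosRat.toReal_add {s t u : PosRat} (h : s + t = u) :
    s.toReal + t.toReal = u.toReal := by
  subst h
  apply Subtype.ext
  simp [PosRat.toReal]

/-! ### Subproduct systems -/

/-- A rational-time subproduct system of two-dimensional Hilbert spaces. The isometry
`E (s + t) → E s ⊗ E t` is written `β h` where `h : s + t = u` and `u` stands for `s + t`; this
only avoids transporting vectors along equalities such as `(r + s) + t = r + (s + t)`. -/
structure RationalSubproductSystem : Type (w + 1) where
  E : PosRat → Type w
  [normed : ∀ t, NormedAddCommGroup (E t)]
  [innerE : ∀ t, InnerProductSpace ℂ (E t)]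
  finrank_eq_two : ∀ t, Module.finrank ℂ (E t) = 2
  β : ∀ {s t u : PosRat}, s + t = u → (E u →ₗᵢ[ℂ] E s ⊗[ℂ] E t)
  assoc : ∀ {r s t rs st u : PosRat} (hrs : r + s = rs) (hst : s + t = st)
    (h₁ : rs + t = u) (h₂ : r + st = u) (x : E u),
    TensorProduct.assocIsometry ℂ (E r) (E s) (E t) ((β hrs).rTensor (E t) (β h₁ x)) =
      (β hst).lTensor (E r) (β h₂ x)

attribute [instance] RationalSubproductSystem.normed RationalSubproductSystem.innerE

namespace RationalSubproductSystem

/-- The first normal form, with parameter `a ∈ (0,1)`. -/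
structure IsForm1 (S : RationalSubproductSystem.{w}) (a : ℝ) (x y : ∀ t, S.E t) : Prop where
  a_pos : 0 < a
  a_lt_one : a < 1
  norm_x : ∀ t, ‖x t‖ = 1
  norm_y : ∀ t, ‖y t‖ = 1
  inner_xy : ∀ t : PosRat, inner ℂ (x t) (y t) = ((a ^ ((t : ℚ) : ℝ) : ℝ) : ℂ)
  β_x : ∀ {s t u : PosRat} (h : s + t = u), S.β h (x u) = x s ⊗ₜ[ℂ] x t
  β_y : ∀ {s t u : PosRat} (h : s + t = u), S.β h (y u) = y s ⊗ₜ[ℂ] y t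

/-- The third normal form, with parameters `c ∈ (0,∞)` and `b ∈ ℝ`. -/
structure IsForm3 (S : RationalSubproductSystem.{w}) (c b : ℝ) (x y : ∀ t, S.E t) : Prop where
  c_pos : 0 < c
  norm_x : ∀ t, ‖x t‖ = 1
  inner_xy : ∀ t, inner ℂ (x t) (y t) = 0
  norm_y : ∀ t : PosRat, ‖y t‖ ^ 2 =
    if c = 1 then ((t : ℚ) : ℝ) else (c ^ (2 * ((t : ℚ) : ℝ)) - 1) / (c ^ 2 - 1)
  β_x : ∀ {s t u : PosRat} (h : s + t = u), S.β h (x u) = x s ⊗ₜ[ℂ] x t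
  β_y : ∀ {s t u : PosRat} (h : s + t = u), S.β h (y u) =
    y s ⊗ₜ[ℂ] x t +
      (((c ^ ((s : ℚ) : ℝ) : ℝ) : ℂ) * Complex.exp (Complex.I * b * ((s : ℚ) : ℂ))) •
        (x s ⊗ₜ[ℂ] y t)

end RationalSubproductSystem

/-! ### Arveson systems -/

/-- The data of an Arveson (product) system before the associativity and measurability axioms:
fibres `E t`, unitaries from `E (s + t)` onto the Hilbert space tensor product of `E s` and `E t`,
and a unitary identification `θ t` of each fibre with a fixed separable Hilbert space `H`. The
standard Borel structure of the total space is the one that makes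
`(t, x) ↦ (t, θ t x)` a Borel isomorphism onto `(0,∞) × H`. In particular every `E t` is a
separable Hilbert space. -/
structure PreArvesonSystem : Type 1 where
  E : PosReal → Type
  [normed : ∀ t, NormedAddCommGroup (E t)]
  [innerE : ∀ t, InnerProductSpace ℂ (E t)]
  β : ∀ {s t u : PosReal}, s + t = u →
    (E u ≃ₗᵢ[ℂ] UniformSpace.Completion (E s ⊗[ℂ] E t))
  H : Type
  [normedH : NormedAddCommGroup H]
  [innerH : InnerProductSpace ℂ H]
  [completeH : CompleteSpace H]
  [separableH : TopologicalSpace.SeparableSpace H]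
  [nontrivialH : Nontrivial H]
  [measurableH : MeasurableSpace H]
  [borelH : BorelSpace H]
  θ : ∀ t, E t ≃ₗᵢ[ℂ] H

attribute [instance] PreArvesonSystem.normed PreArvesonSystem.innerE PreArvesonSystem.normedH
  PreArvesonSystem.innerH PreArvesonSystem.completeH PreArvesonSystem.separableH
  PreArvesonSystem.nontrivialH PreArvesonSystem.measurableH PreArvesonSystem.borelH

/-- The multiplication `E s × E t → E (s + t)`, `(x, y) ↦ β⁻¹ (x ⊗ y)`. -/
def PreArvesonSystem.mul (A : PreArvesonSystem) {s t u : PosReal} (h : s + t = u)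
    (x : A.E s) (y : A.E t) : A.E u :=
  (A.β h).symm ((x ⊗ₜ[ℂ] y : A.E s ⊗[ℂ] A.E t) :
    UniformSpace.Completion (A.E s ⊗[ℂ] A.E t))

/-- An Arveson system: the multiplication is associative and Borel measurable. -/
structure ArvesonSystem : Type 1 extends PreArvesonSystem where
  mul_assoc : ∀ {r s t rs st u : PosReal} (hrs : r + s = rs) (hst : s + t = st)
    (h₁ : rs + t = u) (h₂ : r + st = u) (x : E r) (y : E s) (z : E t),
    toPreArvesonSystem.mul h₁ (toPreArvesonSystem.mul hrs x y) z =
      toPreArvesonSystem.mul h₂ x (toPreArvesonSystem.mul hst y z)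
  measurable_mul : Measurable fun p : (PosReal × PosReal) × (H × H) =>
    θ (p.1.1 + p.1.2)
      (toPreArvesonSystem.mul rfl ((θ p.1.1).symm p.2.1) ((θ p.1.2).symm p.2.2))

namespace ArvesonSystem

/-- A unit: a measurable multiplicative section that does not vanish identically. -/
structure MulUnit (A : ArvesonSystem) : Type where
  val : ∀ t, A.E t
  measurable_val : Measurable fun t => A.θ t (val t)
  mul_val : ∀ {s t u : PosReal} (h : s + t = u), A.mul h (val s) (val t) = val u
  nonzero : ∃ t, val t ≠ 0

/-- Finite products `u¹_{t₁} u²_{t₂} ⋯ uⁿ_{tₙ}` of units, where `t₁ + ⋯ + tₙ = t`. -/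
inductive IsUnitProduct (A : ArvesonSystem) : ∀ t : PosReal, A.E t → Prop
  | of_unit (u : A.MulUnit) (t : PosReal) : IsUnitProduct A t (u.val t)
  | mul {s t r : PosReal} (h : s + t = r) (x : A.E s) (y : A.E t) :
      IsUnitProduct A s x → IsUnitProduct A t y → IsUnitProduct A r (A.mul h x y)

/-- Type `I`: there is a unit, and the products of units span a dense subspace of each fibre. -/
def IsTypeI (A : ArvesonSystem) : Prop :=
  Nonempty A.MulUnit ∧
    ∀ t, (Submodule.span ℂ {x : A.E t | A.IsUnitProduct t x}).topologicalClosure = ⊤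

/-- `c` is the covariance function of the units: `⟨u_t, v_t⟩ = exp (t c(u,v))` for all `t`. -/
def IsCovariance (A : ArvesonSystem) (c : A.MulUnit → A.MulUnit → ℂ) : Prop :=
  ∀ (u v : A.MulUnit) (t : PosReal),
    inner ℂ (u.val t) (v.val t) = Complex.exp ((t : ℝ) * c u v)

/-- Finitely supported functions on a set `X` whose values sum to zero. -/
def sumZero (X : Type) : Submodule ℂ (X →₀ ℂ) :=
  LinearMap.ker (Finsupp.linearCombination ℂ (fun _ : X => (1 : ℂ)))

/-- The linear map `g ↦ (f ↦ ∑ u v, conj (f u) * c u v * g v)` on the functions of sum zero. -/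
def covarianceMap {X : Type} (c : X → X → ℂ) : sumZero X →ₗ[ℂ] (sumZero X → ℂ) :=
  LinearMap.pi fun f =>
    (Finsupp.linearCombination ℂ
      (fun v => (f : X →₀ ℂ).sum fun u a => conj a * c u v)).comp (sumZero X).subtype

/-- The index is `n`: the Hilbert space obtained from the finitely supported functions of sum zero
on the set of units, with the semi-inner product given by the covariance function (divide by the
null vectors, then complete), has dimension `n`. The null vectors `g` are those with
`∑ u v, conj (f u) * c u v * g v = 0` for all `f`, that is, the kernel of `covarianceMap c`, so the
quotient is the range of this map; since `n` is finite, completing does not change the dimension. -/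
def HasIndex (A : ArvesonSystem) (n : ℕ) : Prop :=
  ∃ c : A.MulUnit → A.MulUnit → ℂ, A.IsCovariance c ∧
    Module.rank ℂ (LinearMap.range (covarianceMap c)) = (n : Cardinal)

/-- Type `I_n`: type `I` with index `n`. -/
def IsTypeIn (A : ArvesonSystem) (n : ℕ) : Prop := A.IsTypeI ∧ A.HasIndex n

end ArvesonSystem

/-- A representation of a rational-time subproduct system in an Arveson system: isometric
embeddings `α t : E t → Ẽ t` such that `β̃ ∘ α (s + t) = (α s ⊗ α t) ∘ β`. -/
structure SubproductRepresentation (S : RationalSubproductSystem.{w}) (A : ArvesonSystem) : Type w where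
  α : ∀ t : PosRat, S.E t →ₗᵢ[ℂ] A.E t.toReal
  comm : ∀ {s t u : PosRat} (h : s + t = u) (x : S.E u),
    A.β (PosRat.toReal_add h) (α u x) =
      ((TensorProduct.mapIsometry (α s) (α t) (S.β h x) :
          A.E s.toReal ⊗[ℂ] A.E t.toReal) :
        UniformSpace.Completion (A.E s.toReal ⊗[ℂ] A.E t.toReal))

/-! ### Symmetric Fock spaces over `L²(0,t)` -/

/-- Lebesgue measure on `(0,t)`. -/
abbrev timeMeasure (t : PosReal) : Measure ℝ := volume.restrict (Set.Ioo 0 (t : ℝ))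

/-- Lebesgue measure on `(0,t)ⁿ`. -/
abbrev timeMeasurePi (t : PosReal) (n : ℕ) : Measure (Fin n → ℝ) :=
  Measure.pi fun _ => timeMeasure t

/-- Permuting coordinates preserves Lebesgue measure on `(0,t)ⁿ`. -/
theorem measurePreserving_perm (t : PosReal) (n : ℕ) (σ : Equiv.Perm (Fin n)) :
    MeasurePreserving (fun ω : Fin n → ℝ => ω ∘ σ) (timeMeasurePi t n) (timeMeasurePi t n) :=
  measurePreserving_arrowCongr' (fun _ => timeMeasure t) (fun _ => timeMeasure t) σ.symm
    (MeasurableEquiv.refl ℝ) (fun _ => MeasurePreserving.id _)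

/-- The `n`-th symmetric tensor power of `L²(0,t)`: the functions in
`L²((0,t)ⁿ) = L²(0,t)^{⊗n}` that are invariant under all permutations of the coordinates. -/
def symL2 (t : PosReal) (n : ℕ) : Submodule ℂ (Lp ℂ 2 (timeMeasurePi t n)) where
  carrier := {f | ∀ σ : Equiv.Perm (Fin n),
    (fun ω : Fin n → ℝ => f (ω ∘ σ)) =ᵐ[timeMeasurePi t n] f}
  add_mem' := by
    intro f g hf hg σ
    have hσ := measurePreserving_perm t n σ |>.quasiMeasurePreserving
    filter_upwards [hf σ, hg σ, Lp.coeFn_add f g, hσ.ae (Lp.coeFn_add f g)] with ω h1 h2 h3 h4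
    have h4' : (f + g : Lp ℂ 2 (timeMeasurePi t n)) (ω ∘ σ) = f (ω ∘ σ) + g (ω ∘ σ) := h4
    rw [h4', h3, h1, h2]; rfl
  zero_mem' := by
    intro σ
    have hσ := measurePreserving_perm t n σ |>.quasiMeasurePreserving
    have h0 := Lp.coeFn_zero ℂ 2 (timeMeasurePi t n)
    filter_upwards [h0, hσ.ae h0] with ω h1 h2
    have h2' : (0 : Lp ℂ 2 (timeMeasurePi t n)) (ω ∘ σ) = 0 := h2
    rw [h2', h1]; rfl
  smul_mem' := by
    intro k f hf σ
    have hσ := measurePreserving_perm t n σ |>.quasiMeasurePreserving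
    filter_upwards [hf σ, Lp.coeFn_smul k f, hσ.ae (Lp.coeFn_smul k f)] with ω h1 h3 h4
    have h4' : (k • f : Lp ℂ 2 (timeMeasurePi t n)) (ω ∘ σ) = k • f (ω ∘ σ) := h4
    rw [h4', h3, h1]; rfl

/-- The symmetric Fock space over `L²(0,t)`: the Hilbert space direct sum over `n` of the symmetric
tensor powers of `L²(0,t)`. -/
abbrev Fock (t : PosReal) : Type := lp (fun n : ℕ => symL2 t n) 2

/-- The function `(s₁,…,sₙ) ↦ f s₁ ⋯ f sₙ` is square integrable when `f` is. -/
theorem memLp_tensorPow {t : PosReal} {f : ℝ → ℂ} (hf : MemLp f 2 (timeMeasure t)) (n : ℕ) :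
    MemLp (fun ω : Fin n → ℝ => ∏ i, f (ω i)) 2 (timeMeasurePi t n) := by
  have hm : AEStronglyMeasurable (fun ω : Fin n → ℝ => ∏ i, f (ω i)) (timeMeasurePi t n) :=
    Finset.aestronglyMeasurable_fun_prod _ fun i _ =>
      hf.1.comp_quasiMeasurePreserving (Measure.quasiMeasurePreserving_eval _ i)
  rw [memLp_two_iff_integrable_sq_norm hm]
  have h := (memLp_two_iff_integrable_sq_norm hf.1).1 hf
  have := Integrable.fintype_prod (ι := Fin n) (μ := fun _ => timeMeasure t)
    (f := fun _ x => ‖f x‖ ^ 2) (fun _ => h)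
  simpa [norm_prod, Finset.prod_pow] using this

/-- The symmetric tensor `f ⊗ ⋯ ⊗ f` (`n` factors). -/
def tensorPow {t : PosReal} (f : Lp ℂ 2 (timeMeasure t)) (n : ℕ) : symL2 t n :=
  ⟨(memLp_tensorPow (Lp.memLp f) n).toLp _, by
    intro σ
    have hσ := measurePreserving_perm t n σ |>.quasiMeasurePreserving
    have h := (memLp_tensorPow (Lp.memLp f) n).coeFn_toLp
    filter_upwards [h, hσ.ae h] with ω h1 h2
    have h2' : ((memLp_tensorPow (Lp.memLp f) n).toLp _ : Lp ℂ 2 (timeMeasurePi t n)) (ω ∘ σ) =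
      ∏ i, f ((ω ∘ σ) i) := h2
    rw [h2', h1]
    exact Equiv.prod_comp σ fun i => f (ω i)⟩

theorem norm_tensorPow {t : PosReal} (f : Lp ℂ 2 (timeMeasure t)) (n : ℕ) :
    ‖tensorPow f n‖ ^ 2 = (‖f‖ ^ 2) ^ n := by
  have key : ∀ {α : Type} [MeasurableSpace α] {μ : Measure α} (g : Lp ℂ 2 μ),
      ‖g‖ ^ 2 = ∫ x, ‖g x‖ ^ 2 ∂μ := by
    intro α _ μ g
    have h := @inner_self_eq_norm_sq ℂ (Lp ℂ 2 μ) _ _ _ g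
    rw [← h, L2.inner_def, ← integral_re (L2.integrable_inner g g)]
    exact integral_congr_ae (.of_forall fun x => by
      simp only [inner_self_eq_norm_sq])
  change ‖((tensorPow f n : symL2 t n) : Lp ℂ 2 (timeMeasurePi t n))‖ ^ 2 = _
  rw [key, key, ← Fintype.card_fin n, ← integral_fintype_prod_eq_pow, Fintype.card_fin n]
  refine integral_congr_ae ?_
  filter_upwards [(memLp_tensorPow (Lp.memLp f) n).coeFn_toLp] with ω h
  have h' : ((tensorPow f n : symL2 t n) : Lp ℂ 2 (timeMeasurePi t n)) ω = ∏ i, f (ω i) := h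
  rw [h', norm_prod, Finset.prod_pow]

/-- The exponential (coherent) vector `⨁ₙ (n!)^{-1/2} f^{⊗n}` of the symmetric Fock space, so that
`⟨Exp f, Exp g⟩ = exp ⟨f, g⟩`. -/
def fockExp {t : PosReal} (f : Lp ℂ 2 (timeMeasure t)) : Fock t :=
  ⟨fun n => (((Real.sqrt (n.factorial : ℝ))⁻¹ : ℝ) : ℂ) • tensorPow f n, by
    apply memℓp_gen
    refine (Real.summable_pow_div_factorial (‖f‖ ^ 2)).congr fun n => ?_
    rw [show (2 : ℝ≥0∞).toReal = ((2 : ℕ) : ℝ) by norm_num, Real.rpow_natCast, norm_smul, mul_pow,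
      norm_tensorPow, Complex.norm_real, Real.norm_eq_abs, sq_abs, inv_pow,
      Real.sq_sqrt (by positivity)]
    ring⟩

/-- `ψ` is the vacuum vector `1 ⊕ 0 ⊕ 0 ⊕ ⋯`. -/
def IsVacuum {t : PosReal} (ψ : Fock t) : Prop :=
  (∀ᵐ ω ∂timeMeasurePi t 0, (ψ 0 : Lp ℂ 2 (timeMeasurePi t 0)) ω = 1) ∧ ∀ n, n ≠ 0 → ψ n = 0

/-- `ψ` is the one-particle vector `0 ⊕ f ⊕ 0 ⊕ ⋯`. -/
def IsOneParticle {t : PosReal} (ψ : Fock t) (f : ℝ → ℂ) : Prop :=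
  (∀ᵐ ω ∂timeMeasurePi t 1, (ψ 1 : Lp ℂ 2 (timeMeasurePi t 1)) ω = f (ω 0)) ∧
    ∀ n, n ≠ 1 → ψ n = 0

/-- `h ∈ L²(0,s+t)` is `f ∈ L²(0,s)` followed by the translate of `g ∈ L²(0,t)` by `s`. -/
def IsConcat {s t u : PosReal} (f : Lp ℂ 2 (timeMeasure s)) (g : Lp ℂ 2 (timeMeasure t))
    (h : Lp ℂ 2 (timeMeasure u)) : Prop :=
  (∀ᵐ r ∂timeMeasure s, h r = f r) ∧ ∀ᵐ r ∂timeMeasure t, h ((s : ℝ) + r) = g r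

/-- The restriction to `(0,t)` of a square integrable function on the line. -/
def restrictTime (f : Lp ℂ 2 (volume : Measure ℝ)) (t : PosReal) : Lp ℂ 2 (timeMeasure t) :=
  ((Lp.memLp f).restrict (Set.Ioo 0 (t : ℝ))).toLp f

/-- An identification of an Arveson system with the Arveson system of the symmetric Fock spaces
over `L²(0,t)`: the fibres are identified by unitaries, the multiplication corresponds to
`Fock(L²(0,s)) ⊗ Fock(L²(0,t)) = Fock(L²(0,s) ⊕ L²(s,s+t)) = Fock(L²(0,s+t))`, which is determined
by `Exp f · Exp g = Exp (f ⊕ shift g)`, and the Borel structure is the usual one, for which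
`t ↦ Exp (f restricted to (0,t))` is measurable. -/
structure FockIdentification (A : ArvesonSystem) : Type where
  U : ∀ t, A.E t ≃ₗᵢ[ℂ] Fock t
  map_mul : ∀ {s t u : PosReal} (hu : s + t = u) (f : Lp ℂ 2 (timeMeasure s))
    (g : Lp ℂ 2 (timeMeasure t)) (h : Lp ℂ 2 (timeMeasure u)), IsConcat f g h →
    U u (A.mul hu ((U s).symm (fockExp f)) ((U t).symm (fockExp g))) = fockExp h
  measurable_exp : ∀ f : Lp ℂ 2 (volume : Measure ℝ),
    Measurable fun t : PosReal => A.θ t ((U t).symm (fockExp (restrictTime f t)))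

/-- The normalizing constant: `1` if `c = 1`, and `√(2 ln c / (c² - 1))` otherwise. -/
def normConst (c : ℝ) : ℝ := if c = 1 then 1 else Real.sqrt (2 * Real.log c / (c ^ 2 - 1))

end

/-! Everything is read off from Gram matrices. The exponential vectors `Exp f` are total in the Fock
space, with `⟨Exp f, Exp g⟩ = exp ⟨f, g⟩`. If `h` is the concatenation of `f` and `g`, inner
products in L² add, so their exponentials multiply, and `Exp h ↦ Exp f ⊗ Exp g` extends to a unitary
(`unitaryOfGram`, `fockSplit`). Associativity and measurability of the multiplication are checked on
exponential vectors and extended by density and continuity; the fibres are trivialized by the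
dilation L²(0,1) → L²(0,t).

Type I: the vectors `Exp (z 1_{(0,t)})` are units, their products are the exponentials of step
functions, and step functions are dense in L² (`coherent_mem_closure`).

Index one: the inner product of two units is measurable and multiplicative in time, hence
identically zero or `exp (t γ)`. Cauchy–Schwarz, differentiated at time 0, shows that for a unit `u`
the exponent `γ z` of `⟨Exp (z 1), u⟩` is affine in `conj z`, so `u` is `exp (t a) • Exp (b 1)`
(`exists_unitVal_eq`). The covariance is then `conj a + a' + conj b * b'`, which has rank one on
functions of sum zero.

Representations: `E t` has the basis `x t`, `y t`, so it suffices to find Fock vectors with the same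
Gram matrix and the same multiplication rules (`exists_representation_of_gram`). In form (1) these
are the vacuum and the unit `exp (t ln a) • Exp (l 1)` with `l² = -2 ln a`. In form (3) they are the
vacuum and the one-particle vectors of `A c^s e^{ibs}`, whose translation rule `powFun_add` produces
the factor `c^s e^{ibs}`. -/

noncomputable section

/-! ### Total families in Hilbert spaces -/

section Total

variable {H K : Type*} [NormedAddCommGroup H] [InnerProductSpace ℂ H]
  [NormedAddCommGroup K] [InnerProductSpace ℂ K] {ι : Type*}

/-- A family of vectors is total if its linear span is dense. -/
def HasDenseSpan (v : ι → H) : Prop := Dense (Submodule.span ℂ (Set.range v) : Set H)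

theorem HasDenseSpan.mem_of_isClosed {v : ι → H} (hv : HasDenseSpan v) (V : Submodule ℂ H)
    (hV : IsClosed (V : Set H)) (h : ∀ i, v i ∈ V) (x : H) : x ∈ V := by
  have h1 : (Submodule.span ℂ (Set.range v) : Set H) ⊆ V :=
    Submodule.span_le.2 (Set.range_subset_iff.2 h)
  exact (hV.closure_subset_iff.2 h1) (hv x)

theorem HasDenseSpan.ext_inner {v : ι → H} (hv : HasDenseSpan v) {x y : H}
    (h : ∀ i, inner ℂ (v i) x = inner ℂ (v i) y) : x = y := by
  refine hv.eq_of_inner_left (𝕜 := ℂ) fun u hu => ?_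
  induction hu using Submodule.span_induction with
  | mem u hu => obtain ⟨i, rfl⟩ := hu; rw [← inner_conj_symm, h, inner_conj_symm]
  | zero => simp
  | add a b _ _ ha hb => rw [inner_add_right, inner_add_right, ha, hb]
  | smul c a _ ha => rw [inner_smul_right, inner_smul_right, ha]

theorem HasDenseSpan.ext_clm {v : ι → H} (hv : HasDenseSpan v) {f g : H →L[ℂ] K}
    (h : ∀ i, f (v i) = g (v i)) (x : H) : f x = g x :=
  hv.mem_of_isClosed (LinearMap.eqLocus f.toLinearMap g.toLinearMap)
    (isClosed_eq f.continuous g.continuous) h x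

theorem hasDenseSpan_of_forall_inner_eq_zero [CompleteSpace H] {v : ι → H}
    (h : ∀ x, (∀ i, inner ℂ (v i) x = 0) → x = 0) : HasDenseSpan v := by
  rw [HasDenseSpan, Submodule.dense_iff_topologicalClosure_eq_top,
    Submodule.topologicalClosure_eq_top_iff, Submodule.eq_bot_iff]
  exact fun x hx => h x fun i => hx _ (Submodule.subset_span ⟨i, rfl⟩)

theorem HasDenseSpan.separableSpace [TopologicalSpace ι] [TopologicalSpace.SeparableSpace ι] {v : ι → H}
    (hv : HasDenseSpan v) (hc : Continuous v) : TopologicalSpace.SeparableSpace H := by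
  have h1 := (TopologicalSpace.isSeparable_range hc).span (R := ℂ)
  have h2 := h1.closure
  rw [hv.closure_eq] at h2
  exact TopologicalSpace.isSeparable_univ_iff.1 h2

/-- The squared norm of a combination depends only on its coefficients and the Gram matrix. This
makes `v i ↦ w i` both well defined and isometric on spans. -/
theorem norm_linearCombination_eq_of_gram {v : ι → H} {w : ι → K}
    (h : ∀ i j, inner ℂ (v i) (v j) = inner ℂ (w i) (w j)) (x : ι →₀ ℂ) :
    ‖Finsupp.linearCombination ℂ w x‖ = ‖Finsupp.linearCombination ℂ v x‖ := by
  rw [norm_eq_sqrt_re_inner (𝕜 := ℂ), norm_eq_sqrt_re_inner (𝕜 := ℂ)]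
  simp only [Finsupp.linearCombination_apply, Finsupp.sum, sum_inner, inner_sum, inner_smul_left,
    inner_smul_right, h]

/-- Two total families with the same Gram matrix are carried to each other by a unitary. -/
def unitaryOfGram [CompleteSpace H] [CompleteSpace K] {v : ι → H} {w : ι → K}
    (hv : HasDenseSpan v) (hw : HasDenseSpan w) (h : ∀ i j, inner ℂ (v i) (v j) = inner ℂ (w i) (w j)) :
    H ≃ₗᵢ[ℂ] K :=
  (LinearEquiv.refl ℂ (ι →₀ ℂ)).extendOfIsometry (Finsupp.linearCombination ℂ v)
    (Finsupp.linearCombination ℂ w)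
    (by rw [DenseRange, ← LinearMap.coe_range, Finsupp.range_linearCombination]; exact hv)
    (by rw [DenseRange, ← LinearMap.coe_range, Finsupp.range_linearCombination]; exact hw)
    (norm_linearCombination_eq_of_gram h)

theorem unitaryOfGram_apply [CompleteSpace H] [CompleteSpace K] {v : ι → H} {w : ι → K}
    (hv : HasDenseSpan v) (hw : HasDenseSpan w) (h : ∀ i j, inner ℂ (v i) (v j) = inner ℂ (w i) (w j))
    (i : ι) : unitaryOfGram hv hw h (v i) = w i := by
  have := LinearEquiv.extendOfIsometry_eq (LinearEquiv.refl ℂ (ι →₀ ℂ))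
    (Finsupp.linearCombination ℂ v) (Finsupp.linearCombination ℂ w)
    (by rw [DenseRange, ← LinearMap.coe_range, Finsupp.range_linearCombination]; exact hv)
    (by rw [DenseRange, ← LinearMap.coe_range, Finsupp.range_linearCombination]; exact hw)
    (norm_linearCombination_eq_of_gram h)
    (Finsupp.single i 1)
  simpa [unitaryOfGram] using this

/-- A map into a separable Hilbert space is measurable if its inner products with the vectors
of a total family are. -/
theorem HasDenseSpan.measurable [TopologicalSpace.SeparableSpace H] [MeasurableSpace H]
    [BorelSpace H] {Ω : Type*} [MeasurableSpace Ω] {v : ι → H} (hv : HasDenseSpan v) {φ : Ω → H}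
    (h : ∀ i, Measurable fun ω => inner ℂ (v i) (φ ω)) : Measurable φ := by
  have hx : ∀ x : H, Measurable fun ω => inner ℂ x (φ ω) := by
    intro x
    have hspan : ∀ y ∈ Submodule.span ℂ (Set.range v), Measurable fun ω => inner ℂ y (φ ω) := by
      intro y hy
      induction hy using Submodule.span_induction with
      | mem u hu => obtain ⟨i, rfl⟩ := hu; exact h i
      | zero => simp
      | add a b _ _ ha hb => simp only [inner_add_left]; exact ha.add hb
      | smul c a _ ha => simpa only [inner_smul_left] using ha.const_mul _
    obtain ⟨y, hy, hlim⟩ := mem_closure_iff_seq_limit.1 (hv x)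
    refine measurable_of_tendsto_metrizable (fun n => hspan (y n) (hy n)) ?_
    rw [tendsto_pi_nhds]
    exact fun ω => hlim.inner tendsto_const_nhds
  -- Passage from weak to Borel measurability: a closed ball is cut out by countably many
  -- inequalities on inner products.
  have hball : ∀ (x : H) (r : ℝ), 0 ≤ r → MeasurableSet (φ ⁻¹' Metric.closedBall x r) := by
    intro x r hr
    have hset : φ ⁻¹' Metric.closedBall x r =
        ⋂ n, {ω | ‖inner ℂ (TopologicalSpace.denseSeq H n) (φ ω - x)‖ ≤
          ‖TopologicalSpace.denseSeq H n‖ * r} := by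
      ext ω
      simp only [Set.mem_preimage, mem_closedBall_iff_norm, Set.mem_iInter, Set.mem_ofPred_eq]
      constructor
      · exact fun h n => (norm_inner_le_norm _ _).trans (by gcongr)
      · intro h
        have h2 : ∀ y : H, ‖inner ℂ y (φ ω - x)‖ ≤ ‖y‖ * r := fun y =>
          (TopologicalSpace.denseRange_denseSeq H).induction_on y
            (isClosed_le (by fun_prop) (by fun_prop)) h
        -- Testing with `y = φ ω - x` gives `‖φ ω - x‖² ≤ ‖φ ω - x‖ * r`.
        have h3 := h2 (φ ω - x)
        rw [inner_self_eq_norm_sq_to_K, norm_pow, RCLike.norm_ofReal, abs_norm] at h3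
        by_contra! h4
        nlinarith [norm_nonneg (φ ω - x)]
    rw [hset]
    refine MeasurableSet.iInter fun n => measurableSet_le ?_ measurable_const
    simp only [inner_sub_right]
    exact ((hx _).sub measurable_const).norm
  have : SecondCountableTopology H := UniformSpace.secondCountable_of_separable H
  refine measurable_of_isOpen fun U hU => ?_
  -- An open set is a countable union of closed balls with centres in a dense sequence and rational
  -- radii; `max p.2 0` keeps the radius nonnegative, as `hball` requires.
  obtain ⟨S, hS, hU'⟩ : ∃ S : Set (H × ℝ), S.Countable ∧
      U = ⋃ p ∈ S, Metric.closedBall p.1 (max p.2 0) := by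
    refine ⟨{p | p.1 ∈ Set.range (TopologicalSpace.denseSeq H) ∧ p.2 ∈ Set.range ((↑) : ℚ → ℝ) ∧
      Metric.closedBall p.1 (max p.2 0) ⊆ U}, ?_, ?_⟩
    · refine ((Set.countable_range (TopologicalSpace.denseSeq H)).prod
        (Set.countable_range ((↑) : ℚ → ℝ))).mono fun p hp => Set.mem_prod.2 ⟨hp.1, hp.2.1⟩
    · apply Set.Subset.antisymm
      · intro x hxU
        obtain ⟨ε, hε, hεU⟩ := Metric.isOpen_iff.1 hU x hxU
        obtain ⟨q, hq0, hq⟩ := exists_rat_btwn (show (0 : ℝ) < ε / 2 by positivity)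
        obtain ⟨y, hxy⟩ := (TopologicalSpace.denseRange_denseSeq H).exists_dist_lt x hq0
        simp only [Set.mem_iUnion, Set.mem_ofPred_eq]
        refine ⟨(TopologicalSpace.denseSeq H y, q), ⟨⟨y, rfl⟩, ⟨q, rfl⟩, ?_⟩, ?_⟩
        · intro z hz
          apply hεU
          rw [Metric.mem_closedBall, max_eq_left hq0.le] at hz
          rw [Metric.mem_ball]
          calc dist z x ≤ dist z (TopologicalSpace.denseSeq H y) +
                dist x (TopologicalSpace.denseSeq H y) := dist_triangle_right _ _ _
            _ < ε := by linarith
        · rw [Metric.mem_closedBall, max_eq_left hq0.le]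
          exact hxy.le
      · simp only [Set.iUnion_subset_iff]
        exact fun p hp => hp.2.2
  rw [hU', Set.preimage_iUnion₂]
  exact MeasurableSet.biUnion hS fun p _ => hball _ _ (le_max_right _ _)

end Total

/-! ### Measurable solutions of the exponential Cauchy equation -/

/-- A measurable solution of `F (s + t) = F s * F t` on the line with `F 0 = 1` is `t ↦ exp (t γ)`. -/
theorem exists_exp_of_measurable_of_map_add {F : ℝ → ℂ} (hm : Measurable F) (h0 : F 0 = 1)
    (hadd : ∀ s t, F (s + t) = F s * F t) : ∃ γ : ℂ, ∀ t : ℝ, F t = Complex.exp (t * γ) := by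
  have hne : ∀ t, F t ≠ 0 := fun t ht => by
    have := hadd t (-t)
    rw [add_neg_cancel, h0, ht, zero_mul] at this
    exact one_ne_zero this
  -- `log ‖F‖` is additive and measurable, hence continuous; so `F` is locally bounded and can be
  -- integrated.
  let L : ℝ →+ ℝ :=
    { toFun := fun t => Real.log ‖F t‖
      map_zero' := by simp [h0]
      map_add' := fun s t => by
        rw [hadd, norm_mul, Real.log_mul (norm_ne_zero_iff.2 (hne s)) (norm_ne_zero_iff.2 (hne t))] }
  have hL : Continuous L := MeasureTheory.Measure.AddMonoidHom.continuous_of_measurable L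
    (Real.measurable_log.comp hm.norm)
  have hnorm : Continuous fun t => ‖F t‖ := by
    have : (fun t => ‖F t‖) = fun t => Real.exp (L t) := by
      funext t
      exact (Real.exp_log (norm_pos_iff.2 (hne t))).symm
    rw [this]
    exact Real.continuous_exp.comp hL
  have hloc : LocallyIntegrable F volume :=
    (hnorm.locallyIntegrable (μ := volume)).mono hm.aestronglyMeasurable (by simp)
  have hint : ∀ a b, IntervalIntegrable F volume a b := fun a b =>
    (hloc.integrableOn_isCompact isCompact_uIcc).intervalIntegrable
  -- If every primitive vanished, Lebesgue differentiation would give a zero of `F`.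
  obtain ⟨ε, hε⟩ : ∃ ε, ∫ x in (0 : ℝ)..ε, F x ≠ 0 := by
    by_contra! hall
    obtain ⟨x, hx⟩ := (LocallyIntegrable.ae_hasDerivAt_integral hloc).exists
    have h1 := hx 0
    simp only [hall] at h1
    exact hne x (h1.unique (hasDerivAt_const x (0 : ℂ)))
  -- Integrating `F (t + x) = F t * F x` over `x` in `(0, ε)` writes `F` through its primitive. Each
  -- use gains regularity: first continuity, then differentiability at 0.
  have hF : ∀ t, F t =
      ((∫ x in (0 : ℝ)..(t + ε), F x) - ∫ x in (0 : ℝ)..t, F x) / ∫ x in (0 : ℝ)..ε, F x := by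
    intro t
    rw [eq_div_iff hε, intervalIntegral.integral_interval_sub_left (hint _ _) (hint _ _),
      ← intervalIntegral.integral_const_mul]
    simp only [← hadd]
    rw [intervalIntegral.integral_comp_add_left (fun x => F x) t, add_zero]
  have hcont : Continuous F := by
    have hI := intervalIntegral.continuous_primitive hint 0
    rw [show F = _ from funext hF]
    fun_prop
  have hder : ∀ t, HasDerivAt (fun t => ∫ x in (0 : ℝ)..t, F x) (F t) t := fun t =>
    intervalIntegral.integral_hasDerivAt_right (hint _ _)
      (hcont.stronglyMeasurableAtFilter _ _) hcont.continuousAt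
  obtain ⟨γ, hγ⟩ : ∃ γ, HasDerivAt F γ 0 := by
    have h1 := (((hder (0 + ε)).comp_add_const 0 ε).sub (hder 0)).div_const
      (∫ x in (0 : ℝ)..ε, F x)
    refine ⟨_, h1.congr_of_eventuallyEq (Filter.Eventually.of_forall fun t => ?_)⟩
    exact hF t
  have hFder : ∀ t, HasDerivAt F (γ * F t) t := by
    intro t
    have h1 : HasDerivAt (fun x => F (x - t) * F t) (γ * F t) t := by
      refine HasDerivAt.mul_const ?_ _
      have h2 : HasDerivAt F γ (t - t) := by rwa [sub_self]
      simpa using h2.comp_sub_const t t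
    refine h1.congr_of_eventuallyEq (Filter.Eventually.of_forall fun x => ?_)
    simp only [← hadd, sub_add_cancel]
  refine ⟨γ, fun t => ?_⟩
  have hprod : ∀ t : ℝ, HasDerivAt (fun t : ℝ => F t * Complex.exp (-(t * γ))) 0 t := by
    intro t
    have h1 : HasDerivAt (fun t : ℝ => Complex.exp (-(t * γ))) (Complex.exp (-(t * γ)) * -γ) t := by
      have h2 : HasDerivAt (fun t : ℝ => -((t : ℂ) * γ)) (-γ) t := by
        have h3 := ((hasDerivAt_id t).ofReal_comp.mul_const γ).neg
        rw [Complex.ofReal_one, one_mul] at h3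
        exact h3
      exact h2.cexp
    have h2 := (hFder t).mul h1
    rw [show γ * F t * Complex.exp (-(t * γ)) + F t * (Complex.exp (-(t * γ)) * -γ) = 0 by ring] at h2
    exact h2
  have hconst := is_const_of_deriv_eq_zero (fun t => (hprod t).differentiableAt)
    (fun t => (hprod t).deriv) t 0
  simp only [Complex.ofReal_zero, zero_mul, neg_zero, Complex.exp_zero, h0, mul_one] at hconst
  rw [Complex.exp_neg] at hconst
  field_simp at hconst
  exact hconst

/-- A measurable multiplicative function on the positive half-line without zeros is
`t ↦ exp (t γ)`. -/
theorem exists_exp_of_measurable_of_map_add_posReal {φ : PosReal → ℂ} (hm : Measurable φ)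
    (hne : ∀ t, φ t ≠ 0) (hadd : ∀ s t, φ (s + t) = φ s * φ t) :
    ∃ γ : ℂ, ∀ t : PosReal, φ t = Complex.exp ((t : ℝ) * γ) := by
  -- The extension to the line is `F t = φ r / φ r'` for any positive `r`, `r'` with `r - r' = t`;
  -- `p t` and `n t` are a measurable choice of such a pair.
  let p : ℝ → PosReal := fun t => ⟨t + |t| + 1, by linarith [neg_abs_le t]⟩
  let n : ℝ → PosReal := fun t => ⟨|t| + 1, by positivity⟩
  let F : ℝ → ℂ := fun t => φ (p t) / φ (n t)
  have hp : Measurable p := by unfold p; fun_prop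
  have hn : Measurable n := by unfold n; fun_prop
  have hF : ∀ (t : ℝ) (r r' : PosReal), (r : ℝ) = r' + t → F t = φ r / φ r' := by
    intro t r r' h
    rw [div_eq_div_iff (hne _) (hne _), ← hadd, ← hadd]
    congr 1
    apply Subtype.ext
    simp only [p, n, Positive.coe_add, h]
    ring
  obtain ⟨γ, hγ⟩ := exists_exp_of_measurable_of_map_add (F := F)
    ((hm.comp hp).div (hm.comp hn))
    (by rw [hF 0 (n 0) (n 0) (by simp), div_self (hne _)])
    (fun s t => by
      let a : PosReal := ⟨|s| + |t| + 1, by positivity⟩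
      let b : PosReal := ⟨|s| + |t| + 1 + s, by
        linarith [neg_abs_le s, abs_nonneg t]⟩
      let c : PosReal := ⟨|s| + |t| + 1 + s + t, by
        linarith [neg_abs_le s, neg_abs_le t]⟩
      rw [hF (s + t) c a (by simp only [a, c]; ring), hF s b a rfl, hF t c b rfl]
      field_simp [hne])
  refine ⟨γ, fun t => ?_⟩
  rw [← hγ, hF t (t + t) t (by simp), hadd, mul_div_assoc, div_self (hne _), mul_one]

/-! ### Exponential vectors in the symmetric Fock space -/

theorem inner_tensorPow_left {t : PosReal} (f : Lp ℂ 2 (timeMeasure t)) (n : ℕ) (ψ : symL2 t n) :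
    inner ℂ (tensorPow f n) ψ =
      ∫ ω, conj (∏ i, f (ω i)) * (ψ : Lp ℂ 2 (timeMeasurePi t n)) ω ∂timeMeasurePi t n := by
  change inner ℂ ((tensorPow f n : symL2 t n) : Lp ℂ 2 (timeMeasurePi t n))
    (ψ : Lp ℂ 2 (timeMeasurePi t n)) = _
  rw [L2.inner_def]
  refine integral_congr_ae ?_
  filter_upwards [(memLp_tensorPow (Lp.memLp f) n).coeFn_toLp] with ω h
  have h' : ((tensorPow f n : symL2 t n) : Lp ℂ 2 (timeMeasurePi t n)) ω = ∏ i, f (ω i) := h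
  rw [h', RCLike.inner_apply, mul_comm]

theorem inner_tensorPow {t : PosReal} (f g : Lp ℂ 2 (timeMeasure t)) (n : ℕ) :
    inner ℂ (tensorPow f n) (tensorPow g n) = (inner ℂ f g) ^ n := by
  rw [inner_tensorPow_left, L2.inner_def, ← Fintype.card_fin n, ← integral_fintype_prod_eq_pow,
    Fintype.card_fin n]
  refine integral_congr_ae ?_
  filter_upwards [(memLp_tensorPow (Lp.memLp g) n).coeFn_toLp] with ω h
  have h' : ((tensorPow g n : symL2 t n) : Lp ℂ 2 (timeMeasurePi t n)) ω = ∏ i, g (ω i) := h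
  rw [h', map_prod, ← Finset.prod_mul_distrib]
  exact Finset.prod_congr rfl fun i _ => by rw [RCLike.inner_apply, mul_comm]

theorem inner_smul_left_symL2 {t : PosReal} {n : ℕ} (z : ℂ) (x y : symL2 t n) :
    inner ℂ (z • x) y = conj z * inner ℂ x y := inner_smul_left (𝕜 := ℂ) x y z

theorem inner_smul_right_symL2 {t : PosReal} {n : ℕ} (z : ℂ) (x y : symL2 t n) :
    inner ℂ x (z • y) = z * inner ℂ x y := inner_smul_right (𝕜 := ℂ) x y z

/-- The squared norm of the difference expands into Gram entries that cancel. -/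
theorem tensorPow_smul {t : PosReal} (z : ℂ) (f : Lp ℂ 2 (timeMeasure t)) (n : ℕ) :
    tensorPow (z • f) n = z ^ n • tensorPow f n := by
  have hz : inner ℂ (z • f) (z • f) = conj z * (z * inner ℂ f f) := by
    rw [inner_smul_left, inner_smul_right]
  have h1 : inner ℂ (z • f) f = conj z * inner ℂ f f := inner_smul_left _ _ _
  have h2 : inner ℂ f (z • f) = z * inner ℂ f f := inner_smul_right _ _ _
  rw [← sub_eq_zero, ← @inner_self_eq_zero ℂ, inner_sub_left, inner_sub_right, inner_sub_right]
  simp only [inner_smul_left_symL2, inner_smul_right_symL2]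
  rw [inner_tensorPow, inner_tensorPow, inner_tensorPow, inner_tensorPow, hz, h1, h2, map_pow]
  ring

theorem fockExp_apply {t : PosReal} (f : Lp ℂ 2 (timeMeasure t)) (n : ℕ) :
    fockExp f n = (((Real.sqrt (n.factorial : ℝ))⁻¹ : ℝ) : ℂ) • tensorPow f n := rfl

theorem inner_fockExp {t : PosReal} (f g : Lp ℂ 2 (timeMeasure t)) :
    inner ℂ (fockExp f) (fockExp g) = Complex.exp (inner ℂ f g) := by
  have h := lp.hasSum_inner (𝕜 := ℂ) (fockExp f) (fockExp g)
  have h2 : ∀ n, inner ℂ (fockExp f n) (fockExp g n) = (inner ℂ f g) ^ n / (n.factorial : ℂ) := by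
    intro n
    rw [fockExp_apply, fockExp_apply, inner_smul_left_symL2, inner_smul_right_symL2, inner_tensorPow,
      Complex.conj_ofReal, ← mul_assoc, ← Complex.ofReal_mul, ← mul_inv,
      Real.mul_self_sqrt (by positivity)]
    push_cast
    field_simp
  simp only [h2] at h
  refine h.unique ?_
  rw [Complex.exp_eq_exp_ℂ]
  exact NormedSpace.expSeries_div_hasSum_exp _

/-- The distance from `fockExp f` to `fockExp g` is an explicit continuous function of `f` through
inner products, and it vanishes at `f = g`. -/
theorem continuous_fockExp {t : PosReal} :
    Continuous (fockExp : Lp ℂ 2 (timeMeasure t) → Fock t) := by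
  rw [continuous_iff_continuousAt]
  intro g
  rw [ContinuousAt, tendsto_iff_norm_sub_tendsto_zero]
  have h1 : ∀ f : Lp ℂ 2 (timeMeasure t), ‖fockExp f - fockExp g‖ =
      Real.sqrt (Complex.exp (inner ℂ f f) - Complex.exp (inner ℂ f g) -
        (Complex.exp (inner ℂ g f) - Complex.exp (inner ℂ g g))).re := by
    intro f
    rw [norm_eq_sqrt_re_inner (𝕜 := ℂ), inner_sub_left, inner_sub_right, inner_sub_right]
    simp only [inner_fockExp]
    rfl
  simp only [h1]
  have h2 : Continuous fun f : Lp ℂ 2 (timeMeasure t) =>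
      Real.sqrt (Complex.exp (inner ℂ f f) - Complex.exp (inner ℂ f g) -
        (Complex.exp (inner ℂ g f) - Complex.exp (inner ℂ g g))).re := by
    fun_prop
  have h3 := h2.tendsto g
  simpa using h3

/-- The symmetric functions are the common fixed points of the isometries that permute coordinates.
Closedness gives completeness of each particle space. -/
theorem isClosed_symL2 (t : PosReal) (n : ℕ) :
    IsClosed (symL2 t n : Set (Lp ℂ 2 (timeMeasurePi t n))) := by
  have : (symL2 t n : Set (Lp ℂ 2 (timeMeasurePi t n))) = ⋂ σ : Equiv.Perm (Fin n),
      {f | Lp.compMeasurePreserving _ (measurePreserving_perm t n σ) f = f} := by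
    ext f
    simp only [Set.mem_iInter, Set.mem_ofPred_eq]
    refine forall_congr' fun σ => ?_
    have h := Lp.coeFn_compMeasurePreserving f (measurePreserving_perm t n σ)
    rw [Lp.ext_iff]
    exact ⟨fun h1 => h.trans h1, fun h1 => h.symm.trans h1⟩
  rw [this]
  refine isClosed_iInter fun σ => isClosed_eq ?_ continuous_id
  exact (Lp.isometry_compMeasurePreserving (measurePreserving_perm t n σ)).continuous

instance completeSpace_symL2 (t : PosReal) (n : ℕ) : CompleteSpace (symL2 t n) :=
  (isClosed_symL2 t n).completeSpace_coe

/-! ### Totality of the exponential vectors -/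

/-- Coefficients of a power series in `conj z` that vanishes identically are zero. -/
theorem eq_zero_of_forall_hasSum_conj_pow {c : ℕ → ℂ}
    (h : ∀ z : ℂ, HasSum (fun n => conj z ^ n * c n) 0) (n : ℕ) : c n = 0 := by
  have h2 : ∀ z : ℂ, HasSum (fun n => z ^ n • c n) 0 := fun z => by
    simpa using h (conj z)
  have h3 : HasFPowerSeriesOnBall (0 : ℂ → ℂ) (FormalMultilinearSeries.ofScalars ℂ c) 0 1 := by
    refine ⟨?_, one_pos, fun {y} _ => ?_⟩
    · refine (FormalMultilinearSeries.ofScalars ℂ c).le_radius_of_summable_norm (r := 1) ?_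
      have := (h2 1).summable.norm
      simpa [FormalMultilinearSeries.ofScalars_norm] using this
    · simpa [FormalMultilinearSeries.ofScalars_apply_eq, mul_comm] using h2 y
  have h4 := h3.hasFPowerSeriesAt.eq_zero
  have h5 := FormalMultilinearSeries.coeff_ofScalars (𝕜 := ℂ) (p := c) (n := n)
  rw [h4] at h5
  exact h5.symm.trans rfl

/-- Polarization: the symmetrized product as an alternating sum of pure powers. -/
theorem sum_powerset_prod_sum {R : Type*} [CommRing R] {n : ℕ} (a : Fin n → Fin n → R) :
    ∑ S : Finset (Fin n), (-1) ^ S.card * ∏ i, ∑ j ∈ S, a i j =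
      (-1) ^ n * ∑ σ : Equiv.Perm (Fin n), ∏ i, a i (σ i) := by
  -- Expanding the product selects maps `φ` with image inside `S`.
  have h1 : ∀ S : Finset (Fin n), ∏ i, ∑ j ∈ S, a i j =
      ∑ φ : Fin n → Fin n, if Finset.univ.image φ ⊆ S then ∏ i, a i (φ i) else 0 := by
    intro S
    rw [Finset.prod_univ_sum, ← Finset.sum_filter]
    refine Finset.sum_congr ?_ fun _ _ => rfl
    ext φ
    simp [Fintype.mem_piFinset, Finset.subset_iff]
  simp only [h1, Finset.mul_sum]
  rw [Finset.sum_comm]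
  have h2 : ∀ φ : Fin n → Fin n, (∑ S : Finset (Fin n), (-1 : R) ^ S.card *
      if Finset.univ.image φ ⊆ S then ∏ i, a i (φ i) else 0) =
      if Function.Bijective φ then (-1) ^ n * ∏ i, a i (φ i) else 0 := by
    intro φ
    -- The sum of `(-1)^|S|` over all `S` containing the image of `φ` is the product over `j` of
    -- `-1` (if `j` is in the image) or `-1 + 1 = 0` (if not). Only surjective `φ`, that is
    -- permutations, survive.
    have h3 := Finset.prod_add (fun _ : Fin n => (-1 : R))
      (fun j => if j ∈ Finset.univ.image φ then 0 else 1) Finset.univ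
    have h4 : ∀ S : Finset (Fin n), (-1 : R) ^ S.card *
        (if Finset.univ.image φ ⊆ S then ∏ i, a i (φ i) else 0) =
        ((∏ _j ∈ S, (-1 : R)) * ∏ j ∈ Finset.univ \ S,
          if j ∈ Finset.univ.image φ then 0 else 1) * ∏ i, a i (φ i) := by
      intro S
      rw [Finset.prod_const, mul_assoc]
      congr 1
      by_cases hS : Finset.univ.image φ ⊆ S
      · have h5 : (∏ j ∈ Finset.univ \ S, if j ∈ Finset.univ.image φ then (0 : R) else 1) = 1 :=
          Finset.prod_eq_one fun j hj => if_neg fun h => (Finset.mem_sdiff.1 hj).2 (hS h)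
        rw [if_pos hS, h5, one_mul]
      · rw [if_neg hS]
        obtain ⟨j, hj, hjS⟩ := Finset.not_subset.1 hS
        rw [Finset.prod_eq_zero (i := j) (by simp [hjS]) (by rw [if_pos hj]), zero_mul]
    rw [Finset.powerset_univ] at h3
    simp only [h4]
    rw [← Finset.sum_mul, ← h3]
    by_cases hφ : Function.Bijective φ
    · rw [if_pos hφ]
      congr 1
      rw [Finset.prod_congr rfl (g := fun _ => (-1 : R)), Finset.prod_const, Finset.card_univ,
        Fintype.card_fin]
      intro j _
      rw [if_pos (by simpa using hφ.2 j), add_zero]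
    · rw [if_neg hφ]
      have hs : ¬ Function.Surjective φ := fun h => hφ (Finite.surjective_iff_bijective.1 h)
      obtain ⟨j, hj⟩ := not_forall.1 hs
      rw [Finset.prod_eq_zero (Finset.mem_univ j), zero_mul]
      rw [if_neg (by simpa using hj), neg_add_cancel]
  simp only [h2]
  rw [← Finset.sum_filter]
  refine Eq.symm ?_
  refine Finset.sum_bij (fun σ _ => (σ : Fin n → Fin n)) ?_ ?_ ?_ ?_
  · intro σ _
    exact Finset.mem_filter.2 ⟨Finset.mem_univ _, σ.bijective⟩
  · intro σ _ τ _ h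
    exact DFunLike.coe_injective h
  · intro φ hφ
    exact ⟨Equiv.ofBijective φ (Finset.mem_filter.1 hφ).2, Finset.mem_univ _, rfl⟩
  · intro _ _
    rfl

theorem integrable_symL2 {t : PosReal} {n : ℕ} (ψ : symL2 t n) :
    Integrable (ψ : Lp ℂ 2 (timeMeasurePi t n)) (timeMeasurePi t n) :=
  (Lp.memLp (ψ : Lp ℂ 2 (timeMeasurePi t n))).integrable one_le_two

/-- The integral of a symmetric function over a box vanishes if the function is orthogonal to all
symmetric powers `f ⊗ ⋯ ⊗ f`. -/
theorem setIntegral_box_eq_zero_of_inner_tensorPow_eq_zero {t : PosReal} {n : ℕ} {ψ : symL2 t n}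
    (h : ∀ f : Lp ℂ 2 (timeMeasure t), inner ℂ (tensorPow f n) ψ = 0)
    {B : Fin n → Set ℝ} (hB : ∀ i, MeasurableSet (B i)) :
    ∫ ω in Set.univ.pi B, (ψ : Lp ℂ 2 (timeMeasurePi t n)) ω ∂timeMeasurePi t n = 0 := by
  let a : (Fin n → ℝ) → Fin n → Fin n → ℂ := fun ω i j => (B j).indicator 1 (ω i)
  have ha : ∀ i j, Measurable fun ω => a ω i j := fun i j =>
    (measurable_one.indicator (hB j)).comp (measurable_pi_apply i)
  have hle : ∀ ω i j, ‖a ω i j‖ ≤ 1 := fun ω i j => by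
    by_cases hx : ω i ∈ B j <;> simp [a, hx]
  have hconj : ∀ ω i j, conj (a ω i j) = a ω i j := fun ω i j => by
    by_cases hx : ω i ∈ B j <;> simp [a, hx]
  have hint : ∀ σ : Fin n → Fin n, Integrable (fun ω => (∏ i, a ω i (σ i)) *
      (ψ : Lp ℂ 2 (timeMeasurePi t n)) ω) (timeMeasurePi t n) := fun σ =>
    (integrable_symL2 ψ).bdd_mul (c := 1)
      (Finset.measurable_prod _ fun i _ => ha i (σ i)).aestronglyMeasurable
      (Filter.Eventually.of_forall fun ω => by
        rw [norm_prod]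
        exact Finset.prod_le_one (fun _ _ => norm_nonneg _) fun i _ => hle _ _ _)
  have hS : ∀ S : Finset (Fin n), ∫ ω, (∏ i, ∑ j ∈ S, a ω i j) *
      (ψ : Lp ℂ 2 (timeMeasurePi t n)) ω ∂timeMeasurePi t n = 0 := by
    intro S
    -- Test functions: sums of indicators of the sides of the box over subsets `S`, as polarization
    -- requires.
    let f : Lp ℂ 2 (timeMeasure t) :=
      ∑ j ∈ S, indicatorConstLp 2 (hB j) (measure_ne_top _ _) (1 : ℂ)
    have hf : ∀ᵐ x ∂timeMeasure t, f x = ∑ j ∈ S, (B j).indicator 1 x := by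
      filter_upwards [Lp.coeFn_finsetSum S fun j =>
          indicatorConstLp 2 (hB j) (measure_ne_top (timeMeasure t) _) (1 : ℂ),
        ae_all_iff.2 fun j => indicatorConstLp_coeFn (p := 2) (hs := hB j)
          (hμs := measure_ne_top (timeMeasure t) _) (c := (1 : ℂ))] with x h1 h2
      rw [h1, Finset.sum_apply]
      exact Finset.sum_congr rfl fun j _ => h2 j
    have hf' : ∀ i, ∀ᵐ ω ∂timeMeasurePi t n, f (ω i) = ∑ j ∈ S, a ω i j := fun i =>
      (Measure.quasiMeasurePreserving_eval (fun _ => timeMeasure t) i).ae hf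
    rw [← h f, inner_tensorPow_left]
    refine integral_congr_ae ?_
    filter_upwards [ae_all_iff.2 hf'] with ω h1
    simp only [h1, map_prod, map_sum, hconj]
  have hsum : ∑ σ : Equiv.Perm (Fin n), ∫ ω, (∏ i, a ω i (σ i)) *
      (ψ : Lp ℂ 2 (timeMeasurePi t n)) ω ∂timeMeasurePi t n = 0 := by
    rw [← integral_finsetSum Finset.univ (fun (σ : Equiv.Perm (Fin n)) _ => hint σ)]
    have h1 : ∑ S : Finset (Fin n), (-1 : ℂ) ^ S.card * ∫ ω, (∏ i, ∑ j ∈ S, a ω i j) *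
      (ψ : Lp ℂ 2 (timeMeasurePi t n)) ω ∂timeMeasurePi t n = 0 := by simp [hS]
    simp only [← integral_const_mul] at h1
    rw [← integral_finsetSum] at h1
    · simp only [← mul_assoc, ← Finset.sum_mul, sum_powerset_prod_sum] at h1
      simp only [mul_assoc, integral_const_mul] at h1
      simp only [← Finset.sum_mul]
      exact (mul_eq_zero.1 h1).resolve_left (by simp)
    · intro S _
      refine Integrable.const_mul ?_ _
      simp only [Finset.prod_univ_sum, Finset.sum_mul]
      exact integrable_finsetSum _ fun σ _ => hint σ
  -- By symmetry of `ψ` all permutations contribute the same integral, so `n!` times the box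
  -- integral is zero.
  have hσ : ∀ σ : Equiv.Perm (Fin n), ∫ ω, (∏ i, a ω i (σ i)) *
      (ψ : Lp ℂ 2 (timeMeasurePi t n)) ω ∂timeMeasurePi t n =
      ∫ ω, (∏ i, a ω i i) * (ψ : Lp ℂ 2 (timeMeasurePi t n)) ω ∂timeMeasurePi t n := by
    intro σ
    have hmp := measurePreserving_perm t n σ⁻¹
    have h1 := integral_map (μ := timeMeasurePi t n) hmp.measurable.aemeasurable
      (f := fun ω => (∏ i, a ω i i) * (ψ : Lp ℂ 2 (timeMeasurePi t n)) ω)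
      (by rw [hmp.map_eq]; exact (hint id).aestronglyMeasurable)
    rw [hmp.map_eq] at h1
    rw [h1]
    refine integral_congr_ae ?_
    filter_upwards [ψ.2 σ⁻¹] with ω h2
    rw [h2]
    congr 1
    rw [← Equiv.prod_comp σ fun i => a (ω ∘ ⇑σ⁻¹) i i]
    simp [a]
  simp only [hσ, Finset.sum_const, nsmul_eq_mul] at hsum
  have h0 := (mul_eq_zero.1 hsum).resolve_left (by simp [Fintype.card_perm, Nat.factorial_ne_zero])
  rw [← integral_indicator (MeasurableSet.univ_pi hB), ← h0]
  congr 1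
  funext ω
  by_cases hω : ω ∈ Set.univ.pi B
  · rw [Set.indicator_of_mem hω, Finset.prod_eq_one, one_mul]
    intro i _
    exact Set.indicator_of_mem (hω i trivial) _
  · rw [Set.indicator_of_notMem hω]
    obtain ⟨i, hi⟩ : ∃ i, ω i ∉ B i := by simpa [Set.mem_pi] using hω
    rw [Finset.prod_eq_zero (Finset.mem_univ i), zero_mul]
    exact Set.indicator_of_notMem hi _

/-- Boxes form a π-system generating the σ-algebra, so the vanishing of integrals passes from boxes
to all measurable sets, and the function is zero almost everywhere. -/
theorem eq_zero_of_inner_tensorPow_eq_zero {t : PosReal} {n : ℕ} {ψ : symL2 t n}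
    (h : ∀ f : Lp ℂ 2 (timeMeasure t), inner ℂ (tensorPow f n) ψ = 0) : ψ = 0 := by
  have hint := integrable_symL2 ψ
  have hbox : ∀ B : Fin n → Set ℝ, (∀ i, MeasurableSet (B i)) →
      ∫ ω in Set.univ.pi B, (ψ : Lp ℂ 2 (timeMeasurePi t n)) ω ∂timeMeasurePi t n = 0 :=
    fun B hB => setIntegral_box_eq_zero_of_inner_tensorPow_eq_zero h hB
  have huniv : ∫ ω, (ψ : Lp ℂ 2 (timeMeasurePi t n)) ω ∂timeMeasurePi t n = 0 := by
    have := hbox (fun _ => Set.univ) fun _ => MeasurableSet.univ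
    rwa [Set.pi_univ, setIntegral_univ] at this
  have hall : ∀ s : Set (Fin n → ℝ), MeasurableSet s →
      ∫ ω in s, (ψ : Lp ℂ 2 (timeMeasurePi t n)) ω ∂timeMeasurePi t n = 0 := by
    intro s hs
    refine MeasurableSpace.induction_on_inter (C := fun s _ =>
      ∫ ω in s, (ψ : Lp ℂ 2 (timeMeasurePi t n)) ω ∂timeMeasurePi t n = 0)
      generateFrom_pi.symm isPiSystem_pi ?_ ?_ ?_ ?_ s hs
    · simp
    · rintro _ ⟨B, hB, rfl⟩
      exact hbox B fun i => hB i trivial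
    · intro s hs ih
      have := integral_add_compl hs hint
      rwa [ih, huniv, zero_add] at this
    · intro f hd hf ih
      rw [integral_iUnion hf hd hint.integrableOn]
      simp [ih]
  have h0 := hint.ae_eq_zero_of_forall_setIntegral_eq_zero fun s hs _ => hall s hs
  exact Subtype.ext ((Lp.eq_zero_iff_ae_eq_zero).2 h0)

/-- Scaling `f` by `z` turns the inner product into a power series in `conj z` whose coefficients
separate the particle numbers. -/
theorem inner_fockExp_smul_left {t : PosReal} (f : Lp ℂ 2 (timeMeasure t)) (ψ : Fock t) (z : ℂ) :
    HasSum (fun n => conj z ^ n * ((((Real.sqrt (n.factorial : ℝ))⁻¹ : ℝ) : ℂ) *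
      inner ℂ (tensorPow f n) (ψ n))) (inner ℂ (fockExp (z • f)) ψ) := by
  have h := lp.hasSum_inner (𝕜 := ℂ) (fockExp (z • f)) ψ
  have h2 : ∀ n, inner ℂ (fockExp (z • f) n) (ψ n) =
      conj z ^ n * ((((Real.sqrt (n.factorial : ℝ))⁻¹ : ℝ) : ℂ) *
        inner ℂ (tensorPow f n) (ψ n)) := by
    intro n
    rw [fockExp_apply, inner_smul_left_symL2, tensorPow_smul, inner_smul_left_symL2, map_pow,
      Complex.conj_ofReal]
    ring
  simp only [h2] at h
  exact h

/-- For a vector orthogonal to all `Exp (z • f)` the power series in `conj z` vanishes, so every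
component is orthogonal to every `f ⊗ ⋯ ⊗ f`, hence zero by polarization. -/
theorem hasDenseSpan_fockExp {t : PosReal} :
    HasDenseSpan (fockExp : Lp ℂ 2 (timeMeasure t) → Fock t) := by
  refine hasDenseSpan_of_forall_inner_eq_zero fun ψ hψ => ?_
  ext1
  funext n
  refine eq_zero_of_inner_tensorPow_eq_zero fun f => ?_
  have h1 := eq_zero_of_forall_hasSum_conj_pow (fun z => by
    have := inner_fockExp_smul_left f ψ z
    rwa [hψ] at this) n
  refine (mul_eq_zero.1 h1).resolve_left ?_
  simp [Nat.factorial_ne_zero]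

instance separableSpace_fock (t : PosReal) : TopologicalSpace.SeparableSpace (Fock t) :=
  haveI : Fact ((2 : ℝ≥0∞) ≠ ∞) := ⟨by simp⟩
  hasDenseSpan_fockExp.separableSpace continuous_fockExp

/-! ### Decomposition and dilation of `L²(0,t)` -/

theorem integral_timeMeasure (t : PosReal) (F : ℝ → ℂ) :
    ∫ r, F r ∂timeMeasure t = ∫ r in (0 : ℝ)..t, F r := by
  rw [intervalIntegral.integral_of_le t.2.le, integral_Ioc_eq_integral_Ioo]

/-- Up to the null point `s`, the interval `(0, s+t)` is `(0, s)` together with the translate of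
`(0, t)`. The splitting of L² rests on this identity. -/
theorem timeMeasure_add {s t u : PosReal} (h : s + t = u) :
    timeMeasure u = timeMeasure s + (timeMeasure t).map (fun r => (s : ℝ) + r) := by
  subst h
  have hs := s.2
  have ht := t.2
  have h1 : (timeMeasure t).map (fun r => (s : ℝ) + r) =
      volume.restrict (Set.Ioo (s : ℝ) (s + t)) := by
    have := (measurePreserving_add_left volume (s : ℝ)).restrict_preimage_emb
      (measurableEmbedding_addLeft (s : ℝ)) (Set.Ioo (s : ℝ) (s + t))
    rw [← this.map_eq]
    congr 2
    ext r
    simp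
  rw [h1, ← Measure.restrict_union (by
    rw [Set.disjoint_left]; intro x hx hx'; exact absurd hx.2 hx'.1.not_gt) measurableSet_Ioo]
  refine Measure.restrict_congr_set ?_
  have h2 : ∀ᵐ x ∂(volume : Measure ℝ), x ≠ (s : ℝ) := by simp [ae_iff]
  filter_upwards [h2] with x hx
  refine propext ⟨fun hx' => ?_, fun hx' => ?_⟩
  · rcases lt_or_gt_of_ne hx with h3 | h3
    · exact Or.inl ⟨hx'.1, h3⟩
    · exact Or.inr ⟨h3, hx'.2⟩
  · rcases hx' with h3 | h3
    · exact ⟨h3.1, h3.2.trans (by simpa using ht)⟩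
    · exact ⟨hs.trans h3.1, h3.2⟩

theorem timeMeasure_le {s t u : PosReal} (h : s + t = u) : timeMeasure s ≤ timeMeasure u := by
  rw [timeMeasure_add h]
  exact Measure.le_add_right le_rfl

theorem map_timeMeasure_le {s t u : PosReal} (h : s + t = u) :
    (timeMeasure t).map (fun r => (s : ℝ) + r) ≤ timeMeasure u := by
  rw [timeMeasure_add h]
  exact Measure.le_add_left le_rfl

theorem integral_timeMeasure_add {s t u : PosReal} (h : s + t = u) {F : ℝ → ℂ}
    (hF : Integrable F (timeMeasure u)) : ∫ r, F r ∂timeMeasure u =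
      (∫ r, F r ∂timeMeasure s) + ∫ r, F (s + r) ∂timeMeasure t := by
  have h1 := hF.mono_measure (timeMeasure_le h)
  have h2 := hF.mono_measure (map_timeMeasure_le h)
  rw [timeMeasure_add h, integral_add_measure h1 h2, integral_map (by fun_prop) h2.1]

/-- The restriction of `f ∈ L²(0,s+t)` to `(0,s)`. -/
def leftPart {s t u : PosReal} (h : s + t = u) (f : Lp ℂ 2 (timeMeasure u)) :
    Lp ℂ 2 (timeMeasure s) :=
  ((Lp.memLp f).mono_measure (timeMeasure_le h)).toLp f

theorem memLp_rightPart {s t u : PosReal} (h : s + t = u) (f : Lp ℂ 2 (timeMeasure u)) :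
    MemLp (fun r => f ((s : ℝ) + r)) 2 (timeMeasure t) := by
  have h1 := (Lp.memLp f).mono_measure (map_timeMeasure_le h)
  exact (memLp_map_measure_iff h1.1 (by fun_prop)).1 h1

/-- The restriction of `f ∈ L²(0,s+t)` to `(s,s+t)`, moved to `(0,t)`. -/
def rightPart {s t u : PosReal} (h : s + t = u) (f : Lp ℂ 2 (timeMeasure u)) :
    Lp ℂ 2 (timeMeasure t) :=
  (memLp_rightPart h f).toLp _

theorem isConcat_leftPart_rightPart {s t u : PosReal} (h : s + t = u)
    (f : Lp ℂ 2 (timeMeasure u)) : IsConcat (leftPart h f) (rightPart h f) f := by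
  constructor
  · filter_upwards [((Lp.memLp f).mono_measure (timeMeasure_le h)).coeFn_toLp] with r hr
    exact hr.symm
  · filter_upwards [(memLp_rightPart h f).coeFn_toLp] with r hr
    exact hr.symm

theorem IsConcat.leftPart_eq {s t u : PosReal} {f : Lp ℂ 2 (timeMeasure s)}
    {g : Lp ℂ 2 (timeMeasure t)} {k : Lp ℂ 2 (timeMeasure u)} (hk : IsConcat f g k)
    (h : s + t = u) : leftPart h k = f :=
  Lp.ext (by
    filter_upwards [hk.1, (isConcat_leftPart_rightPart h k).1] with r h1 h2
    rw [← h1, ← h2])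

theorem IsConcat.rightPart_eq {s t u : PosReal} {f : Lp ℂ 2 (timeMeasure s)}
    {g : Lp ℂ 2 (timeMeasure t)} {k : Lp ℂ 2 (timeMeasure u)} (hk : IsConcat f g k)
    (h : s + t = u) : rightPart h k = g :=
  Lp.ext (by
    filter_upwards [hk.2, (isConcat_leftPart_rightPart h k).2] with r h1 h2
    rw [← h1, ← h2])

theorem exists_isConcat {s t u : PosReal} (h : s + t = u) (f : Lp ℂ 2 (timeMeasure s))
    (g : Lp ℂ 2 (timeMeasure t)) : ∃ k : Lp ℂ 2 (timeMeasure u), IsConcat f g k := by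
  let F : ℝ → ℂ := fun r => if r < s then f r else g (r - s)
  have hFm : StronglyMeasurable F :=
    StronglyMeasurable.ite measurableSet_Iio (Lp.stronglyMeasurable f)
      ((Lp.stronglyMeasurable g).comp_measurable (by fun_prop))
  have hFl : ∀ᵐ r ∂timeMeasure s, F r = f r := by
    filter_upwards [ae_restrict_mem measurableSet_Ioo] with r hr
    exact if_pos hr.2
  have hFr : ∀ᵐ r ∂timeMeasure t, F (s + r) = g r := by
    filter_upwards [ae_restrict_mem measurableSet_Ioo] with r hr
    have : ¬ ((s : ℝ) + r < s) := by linarith [hr.1]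
    simp only [F, if_neg this, add_sub_cancel_left]
  have h1 : MemLp F 2 (timeMeasure s) := (memLp_congr_ae hFl).2 (Lp.memLp f)
  have h2 : MemLp F 2 ((timeMeasure t).map (fun r => (s : ℝ) + r)) :=
    (memLp_map_measure_iff hFm.aestronglyMeasurable (by fun_prop)).2
      ((memLp_congr_ae hFr).2 (Lp.memLp g))
  have hF : MemLp F 2 (timeMeasure u) := by
    rw [memLp_two_iff_integrable_sq_norm hFm.aestronglyMeasurable, timeMeasure_add h,
      integrable_add_measure]
    exact ⟨(memLp_two_iff_integrable_sq_norm hFm.aestronglyMeasurable).1 h1,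
      (memLp_two_iff_integrable_sq_norm hFm.aestronglyMeasurable).1 h2⟩
  refine ⟨hF.toLp F, ?_, ?_⟩
  · filter_upwards [hFl, ae_mono (timeMeasure_le h) hF.coeFn_toLp] with r h3 h4
    rw [h4, h3]
  · have h5 := ae_of_ae_map (by fun_prop) (ae_mono (map_timeMeasure_le h) hF.coeFn_toLp)
    filter_upwards [hFr, h5] with r h3 h4
    rw [h4, h3]

/-- Additivity here becomes multiplicativity after exponentiation; this is what makes the Fock
spaces factorize. -/
theorem IsConcat.inner_eq {s t u : PosReal} (h : s + t = u) {f f' : Lp ℂ 2 (timeMeasure s)}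
    {g g' : Lp ℂ 2 (timeMeasure t)} {k k' : Lp ℂ 2 (timeMeasure u)} (hk : IsConcat f g k)
    (hk' : IsConcat f' g' k') : inner ℂ k k' = inner ℂ f f' + inner ℂ g g' := by
  rw [L2.inner_def, L2.inner_def, L2.inner_def, integral_timeMeasure_add h (L2.integrable_inner k k')]
  congr 1
  · refine integral_congr_ae ?_
    filter_upwards [hk.1, hk'.1] with r h1 h2
    rw [h1, h2]
  · refine integral_congr_ae ?_
    filter_upwards [hk.2, hk'.2] with r h1 h2
    rw [h1, h2]

/-- The unit of time. -/
def PosReal.one : PosReal := ⟨1, one_pos⟩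

theorem integral_comp_div (t : PosReal) (F : ℝ → ℂ) :
    ∫ r, F (r / t) ∂timeMeasure t = (t : ℂ) * ∫ r, F r ∂timeMeasure PosReal.one := by
  have ht := t.2.ne'
  rw [integral_timeMeasure, integral_timeMeasure, intervalIntegral.integral_comp_div F ht, zero_div,
    div_self ht]
  simp [PosReal.one]

theorem map_div_timeMeasure (t : PosReal) :
    (timeMeasure t).map (fun r => r / (t : ℝ)) = ENNReal.ofReal t • timeMeasure PosReal.one := by
  have ht := t.2
  have h1 : (volume : Measure ℝ).map (fun r => r / (t : ℝ)) = ENNReal.ofReal t • volume := by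
    have := Real.map_volume_mul_right (a := (t : ℝ)⁻¹) (by positivity)
    simpa [div_eq_mul_inv, abs_of_pos ht] using this
  have h2 : (fun r => r / (t : ℝ)) ⁻¹' Set.Ioo 0 1 = Set.Ioo 0 (t : ℝ) := by
    ext r
    simp [div_lt_one ht, div_pos_iff_of_pos_right ht]
  rw [timeMeasure, ← h2, ← Measure.restrict_map (by fun_prop) measurableSet_Ioo, h1,
    Measure.restrict_smul]
  rfl

theorem memLp_dilation (t : PosReal) (f : Lp ℂ 2 (timeMeasure PosReal.one)) :
    MemLp (fun r => ((Real.sqrt t)⁻¹ : ℂ) * f (r / t)) 2 (timeMeasure t) := by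
  refine MemLp.const_mul ?_ _
  have h1 : MemLp f 2 ((timeMeasure t).map (fun r => r / (t : ℝ))) := by
    rw [map_div_timeMeasure]
    exact (Lp.memLp f).smul_measure (by simp)
  exact (memLp_map_measure_iff h1.1 (by fun_prop)).1 h1

/-- The unitary dilation `L²(0,1) → L²(0,t)`, `f ↦ t^{-1/2} f(· / t)`. -/
def dilation (t : PosReal) (f : Lp ℂ 2 (timeMeasure PosReal.one)) : Lp ℂ 2 (timeMeasure t) :=
  (memLp_dilation t f).toLp _

theorem coeFn_dilation (t : PosReal) (f : Lp ℂ 2 (timeMeasure PosReal.one)) :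
    ∀ᵐ r ∂timeMeasure t, dilation t f r = ((Real.sqrt t)⁻¹ : ℂ) * f (r / t) :=
  (memLp_dilation t f).coeFn_toLp

theorem inner_dilation (t : PosReal) (f g : Lp ℂ 2 (timeMeasure PosReal.one)) :
    inner ℂ (dilation t f) (dilation t g) = inner ℂ f g := by
  have ht : (t : ℂ) ≠ 0 := by exact_mod_cast t.2.ne'
  have hsq : (Real.sqrt t : ℂ) * Real.sqrt t = t := by
    rw [← Complex.ofReal_mul, Real.mul_self_sqrt t.2.le]
  have h1 : inner ℂ (dilation t f) (dilation t g) =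
      ∫ r, (fun r => (t : ℂ)⁻¹ * inner ℂ (f r) (g r)) (r / t) ∂timeMeasure t := by
    rw [L2.inner_def]
    refine integral_congr_ae ?_
    filter_upwards [coeFn_dilation t f, coeFn_dilation t g] with r h1 h2
    rw [h1, h2]
    simp only [RCLike.inner_apply, map_mul, map_inv₀, Complex.conj_ofReal]
    rw [← hsq, mul_inv]
    ring
  rw [h1, integral_comp_div t fun r => (t : ℂ)⁻¹ * inner ℂ (f r) (g r), integral_const_mul,
    ← mul_assoc, mul_inv_cancel₀ ht, one_mul, L2.inner_def]

theorem dilation_surjective (t : PosReal) : Function.Surjective (dilation t) := by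
  intro g
  have ht := t.2
  have hs : (Real.sqrt t : ℂ) ≠ 0 := by
    exact_mod_cast (Real.sqrt_pos.2 ht).ne'
  have hmap : timeMeasure PosReal.one =
      ENNReal.ofReal (t : ℝ)⁻¹ • (timeMeasure t).map (fun r => r / (t : ℝ)) := by
    rw [map_div_timeMeasure, smul_smul, ← ENNReal.ofReal_mul (by positivity),
      inv_mul_cancel₀ ht.ne', ENNReal.ofReal_one, one_smul]
  have hF : StronglyMeasurable fun r : ℝ => (Real.sqrt t : ℂ) * g (t * r) :=
    ((Lp.stronglyMeasurable g).comp_measurable (by fun_prop)).const_mul _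
  have hmem : MemLp (fun r : ℝ => (Real.sqrt t : ℂ) * g (t * r)) 2 (timeMeasure PosReal.one) := by
    rw [hmap]
    refine MemLp.smul_measure ?_ (by simp)
    rw [memLp_map_measure_iff hF.aestronglyMeasurable (by fun_prop)]
    have : (fun r : ℝ => (Real.sqrt t : ℂ) * g (t * r)) ∘ (fun r => r / (t : ℝ)) =
        fun r => (Real.sqrt t : ℂ) * g r := by
      funext r
      simp only [Function.comp, mul_div_cancel₀ r ht.ne']
    rw [this]
    exact (Lp.memLp g).const_mul _
  refine ⟨hmem.toLp _, Lp.ext ?_⟩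
  have h2 : ∀ᵐ r ∂timeMeasure t, hmem.toLp _ (r / (t : ℝ)) = (Real.sqrt t : ℂ) * g r := by
    have h3 := Measure.ae_smul_measure hmem.coeFn_toLp (ENNReal.ofReal t)
    rw [← map_div_timeMeasure] at h3
    have h4 := ae_of_ae_map (by fun_prop) h3
    filter_upwards [h4] with r h5
    rw [h5, mul_div_cancel₀ r ht.ne']
  filter_upwards [coeFn_dilation t (hmem.toLp _), h2] with r h5 h6
  rw [h5, h6, ← mul_assoc, inv_mul_cancel₀ hs, one_mul]

/-- Integrals over `(0, τ ω)` of a jointly measurable function depend measurably on `ω`. -/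
theorem measurable_integral_timeMeasure {Ω : Type*} [MeasurableSpace Ω] {τ : Ω → PosReal}
    (hτ : Measurable τ) {G : Ω → ℝ → ℂ} (hG : Measurable (Function.uncurry G)) :
    Measurable fun ω => ∫ r, G ω r ∂timeMeasure (τ ω) := by
  -- Moving the interval into the integrand makes the measure independent of `ω`, so measurability
  -- of parametric integrals applies.
  have h1 : ∀ ω, ∫ r, G ω r ∂timeMeasure (τ ω) =
      ∫ r : ℝ, (if 0 < r ∧ r < (τ ω : ℝ) then G ω r else 0) := by
    intro ω
    rw [← integral_indicator measurableSet_Ioo]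
    congr 1
    funext r
    simp [Set.indicator_apply]
  simp only [h1]
  refine (StronglyMeasurable.integral_prod_right (ν := volume)
    (f := fun ω r => if 0 < r ∧ r < (τ ω : ℝ) then G ω r else 0) ?_).measurable
  refine (Measurable.ite ?_ hG measurable_const).stronglyMeasurable
  have h2 : Measurable fun p : Ω × ℝ => (τ p.1 : ℝ) :=
    measurable_subtype_coe.comp (hτ.comp measurable_fst)
  exact (measurableSet_lt measurable_const measurable_snd).inter (measurableSet_lt measurable_snd h2)

/-! ### The Hilbert space tensor product -/

section CompletionTensor

variable {E F : Type*} [NormedAddCommGroup E] [InnerProductSpace ℂ E]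
  [NormedAddCommGroup F] [InnerProductSpace ℂ F]

/-- The pure tensor `x ⊗ y` as a vector of the Hilbert space tensor product. -/
def completionTmul : E →L[ℂ] F →L[ℂ] UniformSpace.Completion (E ⊗[ℂ] F) :=
  LinearMap.mkContinuous₂
    ((TensorProduct.mk ℂ E F).compr₂
      (UniformSpace.Completion.toComplₗᵢ (𝕜 := ℂ) (E := E ⊗[ℂ] F)).toLinearMap) 1
    (fun x y => by
      change ‖((x ⊗ₜ[ℂ] y : E ⊗[ℂ] F) : UniformSpace.Completion (E ⊗[ℂ] F))‖ ≤ _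
      rw [UniformSpace.Completion.norm_coe, TensorProduct.norm_tmul, one_mul])

theorem completionTmul_apply (x : E) (y : F) : completionTmul x y =
    ((x ⊗ₜ[ℂ] y : E ⊗[ℂ] F) : UniformSpace.Completion (E ⊗[ℂ] F)) := rfl

theorem inner_completionTmul (x x' : E) (y y' : F) :
    inner ℂ (completionTmul x y) (completionTmul x' y') = inner ℂ x x' * inner ℂ y y' := by
  rw [completionTmul_apply, completionTmul_apply, UniformSpace.Completion.inner_coe,
    TensorProduct.inner_tmul]

/-- Density is used in one factor at a time: `h1` frees the second factor, `h2` the first; pure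
tensors then span the dense algebraic tensor product. -/
theorem HasDenseSpan.completionTmul {ι κ : Type*} {v : ι → E} {w : κ → F} (hv : HasDenseSpan v)
    (hw : HasDenseSpan w) : HasDenseSpan fun p : ι × κ => completionTmul (v p.1) (w p.2) := by
  set V := (Submodule.span ℂ (Set.range fun p : ι × κ =>
    _root_.completionTmul (v p.1) (w p.2))).topologicalClosure with hVdef
  have hV : IsClosed (V : Set (UniformSpace.Completion (E ⊗[ℂ] F))) :=
    Submodule.isClosed_topologicalClosure _
  have h1 : ∀ i y, _root_.completionTmul (v i) y ∈ V := fun i y =>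
    hw.mem_of_isClosed (V.comap (_root_.completionTmul (v i)).toLinearMap)
      (hV.preimage (_root_.completionTmul (v i)).continuous)
      (fun j => Submodule.le_topologicalClosure _ (Submodule.subset_span ⟨(i, j), rfl⟩)) y
  have h2 : ∀ x y, _root_.completionTmul (E := E) (F := F) x y ∈ V := fun x y =>
    hv.mem_of_isClosed (V.comap (_root_.completionTmul.flip y).toLinearMap)
      (hV.preimage (_root_.completionTmul.flip y).continuous) (fun i => h1 i y) x
  rw [HasDenseSpan, Submodule.dense_iff_topologicalClosure_eq_top, ← hVdef, Submodule.eq_top_iff']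
  intro z
  refine UniformSpace.Completion.induction_on z hV fun a => ?_
  induction a using TensorProduct.induction_on with
  | zero => rw [UniformSpace.Completion.coe_zero]; exact V.zero_mem
  | tmul x y => exact h2 x y
  | add a b ha hb => rw [UniformSpace.Completion.coe_add]; exact V.add_mem ha hb

theorem HasDenseSpan.comp_surjective {H ι κ : Type*} [NormedAddCommGroup H] [InnerProductSpace ℂ H]
    {v : ι → H} (hv : HasDenseSpan v) {p : κ → ι} (hp : Function.Surjective p) :
    HasDenseSpan (v ∘ p) := by
  rw [HasDenseSpan, hp.range_comp]
  exact hv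

/-- The unitary `G → E ⊗ F` with `v i ↦ e i ⊗ f i`. -/
def splitUnitary {G ι : Type*} [NormedAddCommGroup G] [InnerProductSpace ℂ G] [CompleteSpace G]
    {v : ι → G} {e : ι → E} {f : ι → F} (hv : HasDenseSpan v)
    (hw : HasDenseSpan fun i => completionTmul (e i) (f i))
    (h : ∀ i j, inner ℂ (v i) (v j) = inner ℂ (e i) (e j) * inner ℂ (f i) (f j)) :
    G ≃ₗᵢ[ℂ] UniformSpace.Completion (E ⊗[ℂ] F) :=
  unitaryOfGram hv hw fun i j => by rw [inner_completionTmul, h]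

theorem splitUnitary_apply {G ι : Type*} [NormedAddCommGroup G] [InnerProductSpace ℂ G]
    [CompleteSpace G] {v : ι → G} {e : ι → E} {f : ι → F} (hv : HasDenseSpan v)
    (hw : HasDenseSpan fun i => completionTmul (e i) (f i))
    (h : ∀ i j, inner ℂ (v i) (v j) = inner ℂ (e i) (e j) * inner ℂ (f i) (f j)) (i : ι) :
    splitUnitary hv hw h (v i) = completionTmul (e i) (f i) :=
  unitaryOfGram_apply hv hw _ i

end CompletionTensor

/-! ### The Arveson system of symmetric Fock spaces -/

/-- The symmetric Fock space over `L²(0,t)`, as a Hilbert space with no further structure. -/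
def FockSpace (t : PosReal) : Type := Fock t

instance (t : PosReal) : NormedAddCommGroup (FockSpace t) :=
  inferInstanceAs (NormedAddCommGroup (Fock t))

instance (t : PosReal) : InnerProductSpace ℂ (FockSpace t) :=
  inferInstanceAs (InnerProductSpace ℂ (Fock t))

instance (t : PosReal) : CompleteSpace (FockSpace t) :=
  inferInstanceAs (CompleteSpace (Fock t))

instance (t : PosReal) : TopologicalSpace.SeparableSpace (FockSpace t) :=
  separableSpace_fock t

/-- The identity map as a unitary from `FockSpace t` to `Fock t`. -/
def fockSpaceEquiv (t : PosReal) : FockSpace t ≃ₗᵢ[ℂ] Fock t :=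
  LinearIsometryEquiv.refl ℂ (Fock t)

/-- The exponential vectors in `FockSpace t`. -/
def coherent {t : PosReal} (f : Lp ℂ 2 (timeMeasure t)) : FockSpace t := fockExp f

theorem inner_coherent {t : PosReal} (f g : Lp ℂ 2 (timeMeasure t)) :
    inner ℂ (coherent f) (coherent g) = Complex.exp (inner ℂ f g) := inner_fockExp f g

theorem continuous_coherent {t : PosReal} :
    Continuous (coherent : Lp ℂ 2 (timeMeasure t) → FockSpace t) := continuous_fockExp

theorem hasDenseSpan_coherent {t : PosReal} :
    HasDenseSpan (coherent : Lp ℂ 2 (timeMeasure t) → FockSpace t) := hasDenseSpan_fockExp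


/-- Indexing the tensors by the single function `k` gives them the same index set as the vectors
`coherent k`, as `splitUnitary` needs. No tensor is lost, since every pair of functions can be
concatenated. -/
theorem hasDenseSpan_coherent_tmul {s t u : PosReal} (h : s + t = u) :
    HasDenseSpan fun k : Lp ℂ 2 (timeMeasure u) =>
      completionTmul (coherent (leftPart h k)) (coherent (rightPart h k)) :=
  (hasDenseSpan_coherent.completionTmul hasDenseSpan_coherent).comp_surjective
    (p := fun k => (leftPart h k, rightPart h k)) fun ⟨f, g⟩ => by
      obtain ⟨k, hk⟩ := exists_isConcat h f g
      exact ⟨k, Prod.ext (hk.leftPart_eq h) (hk.rightPart_eq h)⟩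

theorem inner_coherent_eq_mul {s t u : PosReal} (h : s + t = u)
    (k k' : Lp ℂ 2 (timeMeasure u)) : inner ℂ (coherent k) (coherent k') =
      inner ℂ (coherent (leftPart h k)) (coherent (leftPart h k')) *
        inner ℂ (coherent (rightPart h k)) (coherent (rightPart h k')) := by
  rw [inner_coherent, inner_coherent, inner_coherent, ← Complex.exp_add,
    (isConcat_leftPart_rightPart h k).inner_eq h (isConcat_leftPart_rightPart h k')]

/-- The unitary `Fock(L²(0,s+t)) → Fock(L²(0,s)) ⊗ Fock(L²(0,t))`. -/
def fockSplit {s t u : PosReal} (h : s + t = u) :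
    FockSpace u ≃ₗᵢ[ℂ] UniformSpace.Completion (FockSpace s ⊗[ℂ] FockSpace t) :=
  splitUnitary hasDenseSpan_coherent (hasDenseSpan_coherent_tmul h) (inner_coherent_eq_mul h)

theorem fockSplit_coherent_parts {s t u : PosReal} (h : s + t = u) (k : Lp ℂ 2 (timeMeasure u)) :
    fockSplit h (coherent k) =
      completionTmul (coherent (leftPart h k)) (coherent (rightPart h k)) :=
  splitUnitary_apply hasDenseSpan_coherent (hasDenseSpan_coherent_tmul h) (inner_coherent_eq_mul h) k

theorem fockSplit_coherent {s t u : PosReal} (h : s + t = u) {f : Lp ℂ 2 (timeMeasure s)}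
    {g : Lp ℂ 2 (timeMeasure t)} {k : Lp ℂ 2 (timeMeasure u)} (hk : IsConcat f g k) :
    fockSplit h (coherent k) = completionTmul (coherent f) (coherent g) := by
  obtain rfl := hk.leftPart_eq h
  obtain rfl := hk.rightPart_eq h
  exact fockSplit_coherent_parts h k

/-- The multiplication `Fock(L²(0,s)) × Fock(L²(0,t)) → Fock(L²(0,s+t))`. -/
def fockMul {s t u : PosReal} (h : s + t = u) : FockSpace s →L[ℂ] FockSpace t →L[ℂ] FockSpace u :=
  (ContinuousLinearMap.compL ℂ _ _ _
    (fockSplit h).symm.toContinuousLinearEquiv.toContinuousLinearMap).comp completionTmul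

theorem fockMul_apply {s t u : PosReal} (h : s + t = u) (x : FockSpace s) (y : FockSpace t) :
    fockMul h x y = (fockSplit h).symm (completionTmul x y) := rfl

theorem fockMul_coherent {s t u : PosReal} (h : s + t = u) {f : Lp ℂ 2 (timeMeasure s)}
    {g : Lp ℂ 2 (timeMeasure t)} {k : Lp ℂ 2 (timeMeasure u)} (hk : IsConcat f g k) :
    fockMul h (coherent f) (coherent g) = coherent k := by
  rw [fockMul_apply, ← fockSplit_coherent h hk, LinearIsometryEquiv.symm_apply_apply]

theorem inner_fockMul {s t u : PosReal} (h : s + t = u) (x x' : FockSpace s) (y y' : FockSpace t) :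
    inner ℂ (fockMul h x y) (fockMul h x' y') = inner ℂ x x' * inner ℂ y y' :=
  ((fockSplit h).symm.inner_map_map _ _).trans (inner_completionTmul x x' y y')

theorem ae_timeMeasure_add {s t u : PosReal} (h : s + t = u) {p : ℝ → Prop}
    (hp : MeasurableSet {r | p r}) (hs : ∀ᵐ r ∂timeMeasure s, p r)
    (ht : ∀ᵐ r ∂timeMeasure t, p (s + r)) : ∀ᵐ r ∂timeMeasure u, p r := by
  rw [timeMeasure_add h, ae_add_measure_iff, ae_map_iff (by fun_prop) hp]
  exact ⟨hs, ht⟩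

theorem isConcat_assoc {r s t rs st u : PosReal} (hrs : r + s = rs) (hst : s + t = st)
    {f : Lp ℂ 2 (timeMeasure r)} {g : Lp ℂ 2 (timeMeasure s)} {k : Lp ℂ 2 (timeMeasure t)}
    {fg : Lp ℂ 2 (timeMeasure rs)} {gk : Lp ℂ 2 (timeMeasure st)} {l : Lp ℂ 2 (timeMeasure u)}
    (h1 : IsConcat f g fg) (h2 : IsConcat fg k l) (h3 : IsConcat g k gk) : IsConcat f gk l := by
  have hrs' : (rs : ℝ) = r + s := by rw [← hrs]; rfl
  constructor
  · filter_upwards [h1.1, ae_mono (timeMeasure_le hrs) h2.1] with x h4 h5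
    rw [h5, h4]
  · refine ae_timeMeasure_add hst ?_ ?_ ?_
    · exact measurableSet_eq_fun ((Lp.stronglyMeasurable l).measurable.comp (by fun_prop))
        (Lp.stronglyMeasurable gk).measurable
    · have h4 := ae_of_ae_map (by fun_prop) (ae_mono (map_timeMeasure_le hrs) h2.1)
      filter_upwards [h1.2, h3.1, h4] with x h5 h6 h7
      rw [h7, h5, h6]
    · filter_upwards [h2.2, h3.2] with x h5 h6
      rw [h6, ← h5, hrs', add_assoc]

/-- On exponential vectors both sides are the exponential of the threefold concatenation. The three
arguments are then freed one by one, `z` first, by density and continuity. -/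
theorem fockMul_assoc {r s t rs st u : PosReal} (hrs : r + s = rs) (hst : s + t = st)
    (h₁ : rs + t = u) (h₂ : r + st = u) (x : FockSpace r) (y : FockSpace s) (z : FockSpace t) :
    fockMul h₁ (fockMul hrs x y) z = fockMul h₂ x (fockMul hst y z) := by
  have hexp : ∀ f g k, fockMul h₁ (fockMul hrs (coherent f) (coherent g)) (coherent k) =
      fockMul h₂ (coherent f) (fockMul hst (coherent g) (coherent k)) := by
    intro f g k
    obtain ⟨fg, hfg⟩ := exists_isConcat hrs f g
    obtain ⟨gk, hgk⟩ := exists_isConcat hst g k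
    obtain ⟨l, hl⟩ := exists_isConcat h₁ fg k
    rw [fockMul_coherent hrs hfg, fockMul_coherent hst hgk, fockMul_coherent h₁ hl,
      fockMul_coherent h₂ (isConcat_assoc hrs hst hfg hl hgk)]
  have h1 : ∀ f g z, fockMul h₁ (fockMul hrs (coherent f) (coherent g)) z =
      fockMul h₂ (coherent f) (fockMul hst (coherent g) z) := fun f g =>
    hasDenseSpan_coherent.ext_clm
      (g := (fockMul h₂ (coherent f)).comp (fockMul hst (coherent g))) (hexp f g)
  have h2 : ∀ f y z, fockMul h₁ (fockMul hrs (coherent f) y) z =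
      fockMul h₂ (coherent f) (fockMul hst y z) := fun f y z =>
    hasDenseSpan_coherent.ext_clm
      (f := ((fockMul h₁).flip z).comp (fockMul hrs (coherent f)))
      (g := (fockMul h₂ (coherent f)).comp ((fockMul hst).flip z)) (fun g => h1 f g z) y
  exact hasDenseSpan_coherent.ext_clm
      (f := ((fockMul h₁).flip z).comp ((fockMul hrs).flip y))
      (g := (fockMul h₂).flip (fockMul hst y z)) (fun f => h2 f y z) x

/-! ### Trivialization by dilation and measurability of the multiplication -/

/-- The unitary `Fock(L²(0,t)) → Fock(L²(0,1))` induced by the dilation. -/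
def fockDilation (t : PosReal) : FockSpace t ≃ₗᵢ[ℂ] FockSpace PosReal.one :=
  unitaryOfGram (v := fun f => coherent (dilation t f))
    (hasDenseSpan_coherent.comp_surjective (dilation_surjective t)) hasDenseSpan_coherent
    fun f g => by rw [inner_coherent, inner_coherent, inner_dilation]

theorem fockDilation_coherent (t : PosReal) (f : Lp ℂ 2 (timeMeasure PosReal.one)) :
    fockDilation t (coherent (dilation t f)) = coherent f :=
  unitaryOfGram_apply (v := fun f => coherent (dilation t f)) _ _ _ f

theorem inner_fockDilation (t : PosReal) (f : Lp ℂ 2 (timeMeasure PosReal.one)) (x : FockSpace t) :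
    inner ℂ (coherent f) (fockDilation t x) = inner ℂ (coherent (dilation t f)) x := by
  rw [← fockDilation_coherent t f, LinearIsometryEquiv.inner_map_map]

instance measurableSpace_fock (t : PosReal) : MeasurableSpace (FockSpace t) := borel _

instance borelSpace_fock (t : PosReal) : BorelSpace (FockSpace t) := ⟨rfl⟩

/-- A family of exponential vectors is measurable if its arguments are given by a jointly
measurable function. -/
theorem measurable_fockDilation_coherent {Ω : Type*} [MeasurableSpace Ω] {τ : Ω → PosReal}
    (hτ : Measurable τ) {G : Ω → ℝ → ℂ} (hG : Measurable (Function.uncurry G))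
    {f : ∀ ω, Lp ℂ 2 (timeMeasure (τ ω))} (hf : ∀ ω, ∀ᵐ r ∂timeMeasure (τ ω), f ω r = G ω r) :
    Measurable fun ω => fockDilation (τ ω) (coherent (f ω)) := by
  refine hasDenseSpan_coherent.measurable fun k => ?_
  -- Against a fixed exponential vector the family becomes the exponential of a parametric integral.
  have h1 : ∀ ω, inner ℂ (coherent k) (fockDilation (τ ω) (coherent (f ω))) =
      Complex.exp (∫ r, G ω r * conj (((Real.sqrt (τ ω))⁻¹ : ℂ) * k (r / (τ ω : ℝ)))
        ∂timeMeasure (τ ω)) := by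
    intro ω
    rw [inner_fockDilation, inner_coherent, L2.inner_def]
    congr 1
    refine integral_congr_ae ?_
    filter_upwards [hf ω, coeFn_dilation (τ ω) k] with r h2 h3
    rw [h2, h3, RCLike.inner_apply]
  simp only [h1]
  refine Complex.measurable_exp.comp (measurable_integral_timeMeasure hτ ?_)
  have hk := (Lp.stronglyMeasurable k).measurable
  have hτ' : Measurable fun p : Ω × ℝ => (τ p.1 : ℝ) :=
    measurable_subtype_coe.comp (hτ.comp measurable_fst)
  refine hG.mul (Complex.continuous_conj.measurable.comp (Measurable.mul ?_ ?_))
  · exact (Complex.measurable_ofReal.comp hτ'.sqrt).inv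
  · exact hk.comp (measurable_snd.div hτ')

theorem fockDilation_symm_coherent (t : PosReal) (f : Lp ℂ 2 (timeMeasure PosReal.one)) :
    (fockDilation t).symm (coherent f) = coherent (dilation t f) := by
  rw [← fockDilation_coherent t f, LinearIsometryEquiv.symm_apply_apply]

theorem measurable_posReal_add : Measurable fun p : PosReal × PosReal => p.1 + p.2 :=
  Measurable.subtype_mk (by fun_prop)

/-- The product of two dilated exponential vectors is again an exponential vector, and its argument,
the concatenation `G`, is jointly measurable in the times and the point. -/
theorem measurable_fockMul_coherent (f g : Lp ℂ 2 (timeMeasure PosReal.one)) :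
    Measurable fun p : PosReal × PosReal => fockDilation (p.1 + p.2)
      (fockMul rfl ((fockDilation p.1).symm (coherent f)) ((fockDilation p.2).symm (coherent g))) := by
  let G : PosReal × PosReal → ℝ → ℂ := fun p r =>
    if r < p.1 then ((Real.sqrt p.1)⁻¹ : ℂ) * f (r / p.1)
    else ((Real.sqrt p.2)⁻¹ : ℂ) * g ((r - p.1) / p.2)
  have hG : Measurable (Function.uncurry G) := by
    have hf := (Lp.stronglyMeasurable f).measurable
    have hg := (Lp.stronglyMeasurable g).measurable
    have h1 : Measurable fun q : (PosReal × PosReal) × ℝ => (q.1.1 : ℝ) := by fun_prop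
    have h2 : Measurable fun q : (PosReal × PosReal) × ℝ => (q.1.2 : ℝ) := by fun_prop
    refine Measurable.ite (measurableSet_lt measurable_snd h1) (Measurable.mul ?_ ?_)
      (Measurable.mul ?_ ?_)
    · exact (Complex.measurable_ofReal.comp h1.sqrt).inv
    · exact hf.comp (measurable_snd.div h1)
    · exact (Complex.measurable_ofReal.comp h2.sqrt).inv
    · exact hg.comp ((measurable_snd.sub h1).div h2)
  choose k hk using fun p : PosReal × PosReal =>
    exists_isConcat (rfl : p.1 + p.2 = p.1 + p.2) (dilation p.1 f) (dilation p.2 g)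
  simp only [fockDilation_symm_coherent, fockMul_coherent _ (hk _)]
  refine measurable_fockDilation_coherent measurable_posReal_add hG fun p => ?_
  have hkm := (Lp.stronglyMeasurable (k p)).measurable
  have hGm : Measurable (G p) := hG.comp measurable_prodMk_left
  refine ae_timeMeasure_add (rfl : p.1 + p.2 = p.1 + p.2) (measurableSet_eq_fun hkm hGm) ?_ ?_
  · filter_upwards [(hk p).1, coeFn_dilation p.1 f, ae_restrict_mem measurableSet_Ioo]
      with r h1 h2 h3
    rw [h1, h2]
    exact (if_pos h3.2).symm
  · filter_upwards [(hk p).2, coeFn_dilation p.2 g, ae_restrict_mem measurableSet_Ioo]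
      with r h1 h2 h3
    have h4 : ¬ ((p.1 : ℝ) + r < p.1) := by linarith [h3.1]
    rw [h1, h2]
    simp only [G, if_neg h4, add_sub_cancel_left]

theorem measurable_fockMul_symm (x y : FockSpace PosReal.one) :
    Measurable fun p : PosReal × PosReal => fockDilation (p.1 + p.2)
      (fockMul rfl ((fockDilation p.1).symm x) ((fockDilation p.2).symm y)) := by
  -- Measurability in the times passes from exponential vectors to their span by linearity, and to
  -- all vectors as a pointwise limit; it is applied to each factor in turn.
  have hclosed : ∀ M : PosReal × PosReal → FockSpace PosReal.one →L[ℂ] FockSpace PosReal.one,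
      (∀ f, Measurable fun p => M p (coherent f)) → ∀ z, Measurable fun p => M p z := by
    intro M hM z
    have hspan : ∀ z ∈ Submodule.span ℂ (Set.range (coherent (t := PosReal.one))),
        Measurable fun p => M p z := by
      intro z hz
      induction hz using Submodule.span_induction with
      | mem u hu => obtain ⟨f, rfl⟩ := hu; exact hM f
      | zero => simp only [map_zero]; exact measurable_const
      | add a b _ _ ha hb => simp only [map_add]; exact ha.add hb
      | smul c a _ ha => simp only [map_smul]; exact ha.const_smul c
    obtain ⟨w, hw, hlim⟩ := mem_closure_iff_seq_limit.1 (hasDenseSpan_coherent z)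
    refine measurable_of_tendsto_metrizable (fun n => hspan (w n) (hw n)) ?_
    rw [tendsto_pi_nhds]
    exact fun p => ((M p).continuous.tendsto z).comp hlim
  have h1 : ∀ f y, Measurable fun p : PosReal × PosReal => fockDilation (p.1 + p.2)
      (fockMul rfl ((fockDilation p.1).symm (coherent f)) ((fockDilation p.2).symm y)) := fun f y =>
    hclosed (fun p => (fockDilation (p.1 + p.2)).toContinuousLinearEquiv.toContinuousLinearMap.comp
      ((fockMul rfl ((fockDilation p.1).symm (coherent f))).comp
        (fockDilation p.2).symm.toContinuousLinearEquiv.toContinuousLinearMap))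
      (fun g => measurable_fockMul_coherent f g) y
  exact hclosed (fun p =>
    (fockDilation (p.1 + p.2)).toContinuousLinearEquiv.toContinuousLinearMap.comp
      (((fockMul rfl).flip ((fockDilation p.2).symm y)).comp
        (fockDilation p.1).symm.toContinuousLinearEquiv.toContinuousLinearMap))
    (fun f => h1 f y) x

instance nontrivial_fock (t : PosReal) : Nontrivial (FockSpace t) :=
  ⟨coherent 0, 0, fun h => by
    have := inner_coherent (t := t) 0 0
    rw [h] at this
    simp at this⟩

/-- The symmetric Fock spaces over `L²(0,t)` with their unitaries and their trivialization. -/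
def fockPre : PreArvesonSystem where
  E := fun t => FockSpace t
  β := fun h => fockSplit h
  H := FockSpace PosReal.one
  θ := fun t => fockDilation t

/-- A Carathéodory argument: continuous in the pair of vectors and measurable in the pair of times
implies jointly measurable. -/
theorem measurable_fockMul : Measurable
    fun p : (PosReal × PosReal) × (FockSpace PosReal.one × FockSpace PosReal.one) =>
    fockDilation (p.1.1 + p.1.2)
      (fockMul rfl ((fockDilation p.1.1).symm p.2.1) ((fockDilation p.1.2).symm p.2.2)) := by
  have : SecondCountableTopology (FockSpace PosReal.one) := UniformSpace.secondCountable_of_separable _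
  have h1 := measurable_uncurry_of_continuous_of_measurable
    (u := fun (z : FockSpace PosReal.one × FockSpace PosReal.one) (p : PosReal × PosReal) =>
      fockDilation (p.1 + p.2)
        (fockMul rfl ((fockDilation p.1).symm z.1) ((fockDilation p.2).symm z.2)))
    (fun p => (fockDilation (p.1 + p.2)).continuous.comp
      (((fockMul (rfl : p.1 + p.2 = p.1 + p.2)).continuous.comp
        ((fockDilation p.1).symm.continuous.comp continuous_fst)).clm_apply
          ((fockDilation p.2).symm.continuous.comp continuous_snd)))
    (fun z => measurable_fockMul_symm z.1 z.2)
  have h2 : Measurable fun p : (PosReal × PosReal) ×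
      (FockSpace PosReal.one × FockSpace PosReal.one) => (p.2, p.1) := measurable_swap
  have h3 := h1.comp h2
  simp only [Function.comp_def, Function.uncurry] at h3
  exact h3

/-- The Arveson system of symmetric Fock spaces over `L²(0,t)`. -/
def fockArveson : ArvesonSystem where
  toPreArvesonSystem := fockPre
  mul_assoc := fun hrs hst h₁ h₂ x y z => fockMul_assoc hrs hst h₁ h₂ x y z
  measurable_mul := measurable_fockMul

/-- The identity identification of `fockArveson` with the symmetric Fock spaces. -/
def fockIdentification : FockIdentification fockArveson where
  U := fun t => fockSpaceEquiv t
  map_mul := fun hu _ _ _ hh => congrArg (fockSpaceEquiv _) (fockMul_coherent hu hh)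
  measurable_exp := fun f => by
    refine measurable_fockDilation_coherent measurable_id (G := fun _ r => f r)
      ((Lp.stronglyMeasurable f).measurable.comp measurable_snd) fun t => ?_
    exact ((Lp.memLp f).restrict (Set.Ioo 0 (t : ℝ))).coeFn_toLp

/-! ### Exponential units -/

/-- The constant function `z` on `(0,t)`. -/
def constLp (z : ℂ) (t : PosReal) : Lp ℂ 2 (timeMeasure t) := Lp.const 2 (timeMeasure t) z

theorem coeFn_constLp (z : ℂ) (t : PosReal) : ∀ᵐ r ∂timeMeasure t, constLp z t r = z :=
  Lp.coeFn_const ..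

theorem inner_constLp (z w : ℂ) (t : PosReal) :
    inner ℂ (constLp z t) (constLp w t) = (t : ℝ) * (conj z * w) := by
  have h1 : inner ℂ (constLp z t) (constLp w t) = ∫ _r, w * conj z ∂timeMeasure t := by
    rw [L2.inner_def]
    refine integral_congr_ae ?_
    filter_upwards [coeFn_constLp z t, coeFn_constLp w t] with r h1 h2
    rw [h1, h2, RCLike.inner_apply]
  rw [h1, integral_timeMeasure, intervalIntegral.integral_const, sub_zero, Complex.real_smul,
    mul_comm w]

theorem isConcat_constLp (z : ℂ) (s t u : PosReal) (h : s + t = u) :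
    IsConcat (constLp z s) (constLp z t) (constLp z u) := by
  constructor
  · filter_upwards [coeFn_constLp z s, ae_mono (timeMeasure_le h) (coeFn_constLp z u)] with r h1 h2
    rw [h1, h2]
  · filter_upwards [coeFn_constLp z t, ae_of_ae_map (by fun_prop)
      (ae_mono (map_timeMeasure_le h) (coeFn_constLp z u))] with r h1 h2
    rw [h1, h2]

theorem inner_coherent_constLp (z w : ℂ) (t : PosReal) :
    inner ℂ (coherent (constLp z t)) (coherent (constLp w t)) =
      Complex.exp ((t : ℝ) * (conj z * w)) := by
  rw [inner_coherent, inner_constLp]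

theorem coherent_ne_zero {t : PosReal} (f : Lp ℂ 2 (timeMeasure t)) : coherent f ≠ 0 := fun h => by
  have h1 := inner_coherent f f
  rw [h, inner_zero_left] at h1
  exact Complex.exp_ne_zero _ h1.symm

/-- The unit `t ↦ exp (t a) • Exp (z 1_{(0,t)})`. -/
def expUnit (a z : ℂ) : fockArveson.MulUnit where
  val := fun t => (Complex.exp ((t : ℝ) * a) • coherent (constLp z t) : FockSpace t)
  measurable_val := by
    have h1 : Measurable fun t : PosReal => fockDilation t (coherent (constLp z t)) :=
      measurable_fockDilation_coherent measurable_id (G := fun _ _ => z) measurable_const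
        fun t => coeFn_constLp z t
    have h2 : Measurable fun t : PosReal => Complex.exp ((t : ℝ) * a) := by fun_prop
    have h3 := h2.smul h1
    have h4 : ((fun t : PosReal => Complex.exp ((t : ℝ) * a)) • fun t : PosReal =>
        fockDilation t (coherent (constLp z t))) = fun t : PosReal =>
        fockDilation t (Complex.exp ((t : ℝ) * a) • coherent (constLp z t)) :=
      funext fun t => ((fockDilation t).map_smul _ _).symm
    rw [h4] at h3
    exact h3
  mul_val := fun {s t u} h => by
    change fockMul h (Complex.exp ((s : ℝ) * a) • coherent (constLp z s))
      (Complex.exp ((t : ℝ) * a) • coherent (constLp z t)) =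
      Complex.exp ((u : ℝ) * a) • coherent (constLp z u)
    rw [map_smul, map_smul, smul_apply, smul_smul, ← Complex.exp_add,
      fockMul_coherent h (isConcat_constLp z s t u h), ← h]
    congr 2
    push_cast [Positive.coe_add]
    ring
  nonzero := ⟨PosReal.one, smul_ne_zero (Complex.exp_ne_zero _) (coherent_ne_zero _)⟩

theorem expUnit_val (a z : ℂ) (t : PosReal) : (expUnit a z).val t =
    (Complex.exp ((t : ℝ) * a) • coherent (constLp z t) : FockSpace t) := rfl

/-! ### Products of exponential units are total -/

theorem coherent_eq_fockMul {s t u : PosReal} (h : s + t = u) (k : Lp ℂ 2 (timeMeasure u)) :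
    coherent k = fockMul h (coherent (leftPart h k)) (coherent (rightPart h k)) :=
  (fockMul_coherent h (isConcat_leftPart_rightPart h k)).symm

/-- Induction on the number `n + 1` of cells of length `δ`: the first cell is split off, and the
remainder is a step function with shifted values. The family `P` is left general because it serves
twice: for products of units, and for vectors that do not distinguish two multiplicative sections.
-/
theorem coherent_step_mem {P : ∀ t, Set (FockSpace t)}
    (hc : ∀ z t, coherent (constLp z t) ∈ P t)
    (hm : ∀ {s t u : PosReal} (h : s + t = u), ∀ x ∈ P s, ∀ y ∈ P t, fockMul h x y ∈ P u)
    (δ : PosReal) (n : ℕ) : ∀ (t : PosReal) (_ : (t : ℝ) = (n + 1) * δ) (z : ℕ → ℂ)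
      (k : Lp ℂ 2 (timeMeasure t)) (_ : ∀ᵐ r ∂timeMeasure t, k r = z ⌊r / δ⌋₊),
      coherent k ∈ P t := by
  have hδ := δ.2
  have hfloor : ∀ᵐ r ∂timeMeasure δ, ⌊r / (δ : ℝ)⌋₊ = 0 := by
    filter_upwards [ae_restrict_mem measurableSet_Ioo] with r hr
    rw [Nat.floor_eq_zero, div_lt_one hδ]
    exact hr.2
  induction n with
  | zero =>
    intro t ht z k hk
    obtain rfl : t = δ := Subtype.ext (by simpa using ht)
    have : k = constLp (z 0) t := Lp.ext (by
      filter_upwards [hk, hfloor, coeFn_constLp (z 0) t] with r h1 h2 h3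
      rw [h1, h2, h3])
    rw [this]
    exact hc _ _
  | succ n ih =>
    intro t ht z k hk
    let t' : PosReal := ⟨(n + 1) * δ, by positivity⟩
    have h : δ + t' = t := Subtype.ext (by
      simp only [t', Positive.coe_add, ht]
      push_cast
      ring)
    have hkk := isConcat_leftPart_rightPart h k
    rw [coherent_eq_fockMul h]
    refine hm h _ ?_ _ ?_
    · have : leftPart h k = constLp (z 0) δ := Lp.ext (by
        filter_upwards [hkk.1, ae_mono (timeMeasure_le h) hk, hfloor, coeFn_constLp (z 0) δ]
          with r h1 h2 h3 h4
        rw [← h1, h2, h3, h4])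
      rw [this]
      exact hc _ _
    · refine ih t' rfl (fun j => z (j + 1)) _ ?_
      filter_upwards [hkk.2, ae_of_ae_map (by fun_prop) (ae_mono (map_timeMeasure_le h) hk),
        ae_restrict_mem measurableSet_Ioo] with r h1 h2 h3
      rw [← h1, h2, add_div, div_self hδ.ne', add_comm 1,
        Nat.floor_add_one (div_nonneg h3.1.le hδ.le)]

theorem norm_sub_toLp_sq {t : PosReal} {f g : ℝ → ℂ} (hf : MemLp f 2 (timeMeasure t))
    (hg : MemLp g 2 (timeMeasure t)) :
    ‖hf.toLp f - hg.toLp g‖ ^ 2 = ∫ r, ‖f r - g r‖ ^ 2 ∂timeMeasure t := by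
  rw [← hf.toLp_sub hg, ← @inner_self_eq_norm_sq ℂ, L2.inner_def,
    ← integral_re (L2.integrable_inner _ _)]
  refine integral_congr_ae ?_
  filter_upwards [(hf.sub hg).coeFn_toLp] with r h
  simp only [inner_self_eq_norm_sq, h, Pi.sub_apply]

/-- Bounded continuous functions are dense in L². Sampling one at the left endpoints of cells of
length `t / (n + 1)` gives step functions converging in L² by dominated convergence, and `coherent`
is continuous. -/
theorem coherent_mem_closure {P : ∀ t, Set (FockSpace t)}
    (hc : ∀ z t, coherent (constLp z t) ∈ P t)
    (hm : ∀ {s t u : PosReal} (h : s + t = u), ∀ x ∈ P s, ∀ y ∈ P t, fockMul h x y ∈ P u)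
    {t : PosReal} (f : Lp ℂ 2 (timeMeasure t)) : coherent f ∈ closure (P t) := by
  have ht := t.2
  refine (BoundedContinuousFunction.toLp_denseRange ℂ (timeMeasure t) (p := 2) ℂ
    (by simp)).induction_on (p := fun f => coherent f ∈ closure (P t)) f
    (isClosed_closure.preimage continuous_coherent) fun F => ?_
  let δ : ℕ → PosReal := fun n => ⟨t / (n + 1), by positivity⟩
  have hδ : Filter.Tendsto (fun n => (δ n : ℝ)) Filter.atTop (nhds 0) := by
    have := tendsto_one_div_add_atTop_nhds_zero_nat.const_mul (t : ℝ)
    simpa [δ, div_eq_mul_inv] using this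
  let g : ℕ → ℝ → ℂ := fun n r => F (⌊r / δ n⌋₊ * δ n)
  have hgm : ∀ n, Measurable (g n) := fun n => F.continuous.measurable.comp
    ((measurable_from_top.comp (Nat.measurable_floor.comp (measurable_id.div_const _))).mul_const _)
  have hg : ∀ n, MemLp (g n) 2 (timeMeasure t) := fun n =>
    MemLp.of_bound (hgm n).aestronglyMeasurable ‖F‖ (Filter.Eventually.of_forall fun r =>
      F.norm_coe_le_norm _)
  have hF : MemLp F 2 (timeMeasure t) :=
    MemLp.of_bound F.continuous.aestronglyMeasurable ‖F‖ (Filter.Eventually.of_forall fun r =>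
      F.norm_coe_le_norm _)
  have hFeq : BoundedContinuousFunction.toLp 2 (timeMeasure t) ℂ F = hF.toLp F := Lp.ext (by
    filter_upwards [BoundedContinuousFunction.coeFn_toLp (p := 2) (timeMeasure t) ℂ F,
      hF.coeFn_toLp] with r h1 h2
    rw [h1, h2])
  have hmem : ∀ n, coherent ((hg n).toLp (g n)) ∈ P t := fun n =>
    coherent_step_mem hc hm (δ n) n t (by simp only [δ]; field_simp) (fun j => F (j * δ n)) _
      (hg n).coeFn_toLp
  have hlim : Filter.Tendsto (fun n => (hg n).toLp (g n)) Filter.atTop (nhds (hF.toLp F)) := by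
    rw [tendsto_iff_norm_sub_tendsto_zero]
    have hsq : Filter.Tendsto (fun n => ‖(hg n).toLp (g n) - hF.toLp F‖ ^ 2) Filter.atTop
        (nhds 0) := by
      simp only [norm_sub_toLp_sq]
      have h0 : (0 : ℝ) = ∫ r, (0 : ℝ) ∂timeMeasure t := by simp
      rw [h0]
      refine tendsto_integral_of_dominated_convergence (fun _ => (2 * ‖F‖) ^ 2) ?_
        (integrable_const _) ?_ ?_
      · exact fun n => (((hgm n).sub F.continuous.measurable).norm.pow_const 2).aestronglyMeasurable
      · intro n
        refine Filter.Eventually.of_forall fun r => ?_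
        rw [norm_pow, norm_norm]
        gcongr
        calc ‖g n r - F r‖ ≤ ‖g n r‖ + ‖F r‖ := norm_sub_le _ _
          _ ≤ 2 * ‖F‖ := by
            linarith [F.norm_coe_le_norm (⌊r / δ n⌋₊ * δ n), F.norm_coe_le_norm r]
      · filter_upwards [ae_restrict_mem measurableSet_Ioo] with r hr
        have h1 : Filter.Tendsto (fun n => (⌊r / δ n⌋₊ * δ n : ℝ)) Filter.atTop (nhds r) := by
          rw [tendsto_iff_dist_tendsto_zero]
          refine squeeze_zero (fun n => dist_nonneg) (fun n => ?_) hδ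
          have hp := (δ n).2
          have h2 := Nat.floor_le (div_nonneg hr.1.le hp.le)
          have h3 := Nat.lt_floor_add_one (r / (δ n : ℝ))
          rw [le_div_iff₀ hp] at h2
          rw [div_lt_iff₀ hp] at h3
          rw [Real.dist_eq, abs_le]
          constructor <;> linarith
        have h2 := ((F.continuous.tendsto r).comp h1).sub_const (F r)
        have h3 := (h2.norm).pow 2
        simpa using h3
    have := hsq.sqrt
    simpa using this
  rw [hFeq]
  exact mem_closure_of_tendsto ((continuous_coherent.tendsto _).comp hlim)
    (Filter.Eventually.of_forall hmem)

theorem isTypeI_fockArveson : fockArveson.IsTypeI := by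
  refine ⟨⟨expUnit 0 0⟩, fun t => ?_⟩
  rw [← Submodule.dense_iff_topologicalClosure_eq_top]
  refine fun x => ?_
  rw [← Submodule.topologicalClosure_coe]
  refine hasDenseSpan_coherent.mem_of_isClosed (H := FockSpace t) _
    (Submodule.isClosed_topologicalClosure _) (fun f => ?_) x
  have h1 := coherent_mem_closure (P := fun t => {x | fockArveson.IsUnitProduct t x})
    (fun z t => by
      have := ArvesonSystem.IsUnitProduct.of_unit (A := fockArveson) (expUnit 0 z) t
      rwa [expUnit_val, mul_zero, Complex.exp_zero, one_smul] at this)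
    (fun h x hx y hy => ArvesonSystem.IsUnitProduct.mul (A := fockArveson) h x y hx hy) f
  exact closure_mono Submodule.subset_span h1

/-! ### Classification of the units -/

/-- The value of a unit, as a vector of the symmetric Fock space. -/
def unitVal (u : fockArveson.MulUnit) (t : PosReal) : FockSpace t := u.val t

theorem unitVal_mul (u : fockArveson.MulUnit) {s t r : PosReal} (h : s + t = r) :
    fockMul h (unitVal u s) (unitVal u t) = unitVal u r := u.mul_val h

theorem unitVal_expUnit (a z : ℂ) (t : PosReal) :
    unitVal (expUnit a z) t = Complex.exp ((t : ℝ) * a) • coherent (constLp z t) := rfl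

theorem inner_unitVal_add (u v : fockArveson.MulUnit) (s t : PosReal) :
    inner ℂ (unitVal u (s + t)) (unitVal v (s + t)) =
      inner ℂ (unitVal u s) (unitVal v s) * inner ℂ (unitVal u t) (unitVal v t) := by
  rw [← unitVal_mul u rfl, ← unitVal_mul v rfl, inner_fockMul]

theorem measurable_inner_unitVal (u v : fockArveson.MulUnit) :
    Measurable fun t => inner ℂ (unitVal u t) (unitVal v t) := by
  have : SecondCountableTopology (FockSpace PosReal.one) :=
    UniformSpace.secondCountable_of_separable _
  have hu : Measurable fun t => fockDilation t (unitVal u t) := u.measurable_val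
  have hv : Measurable fun t => fockDilation t (unitVal v t) := v.measurable_val
  simpa only [LinearIsometryEquiv.inner_map_map] using hu.inner (𝕜 := ℂ) hv

/-- By multiplicativity a zero at `t₀` forces zeros at all `t₀ / 2^n`, and then at every later time,
hence everywhere. Without zeros the Cauchy equation applies. -/
theorem inner_unitVal_eq_zero_or_exp (u v : fockArveson.MulUnit) :
    (∀ t, inner ℂ (unitVal u t) (unitVal v t) = 0) ∨
      ∃ γ : ℂ, ∀ t : PosReal, inner ℂ (unitVal u t) (unitVal v t) = Complex.exp ((t : ℝ) * γ) := by
  by_cases h : ∃ t, inner ℂ (unitVal u t) (unitVal v t) = 0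
  · left
    obtain ⟨t₀, h0⟩ := h
    have ht₀ := t₀.2
    have h1 : ∀ n : ℕ, ∀ s : PosReal, (s : ℝ) = t₀ / 2 ^ n →
        inner ℂ (unitVal u s) (unitVal v s) = 0 := by
      intro n
      induction n with
      | zero => intro s hs; obtain rfl : s = t₀ := Subtype.ext (by simpa using hs); exact h0
      | succ n ih =>
        intro s hs
        have h2 := ih (s + s) (by rw [Positive.coe_add, hs, pow_succ]; field_simp; ring)
        rw [inner_unitVal_add] at h2
        exact mul_self_eq_zero.1 h2
    intro t
    obtain ⟨n, hn⟩ := exists_nat_gt ((t₀ : ℝ) / t)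
    have h2 : (n : ℝ) < 2 ^ n := by exact_mod_cast Nat.lt_two_pow_self
    have hlt : (t₀ : ℝ) / 2 ^ n < t := by
      rw [div_lt_iff₀ t.2] at hn
      rw [div_lt_iff₀ (by positivity)]
      nlinarith [t.2]
    let s : PosReal := ⟨t₀ / 2 ^ n, by positivity⟩
    let r : PosReal := ⟨t - t₀ / 2 ^ n, by linarith⟩
    have hsr : s + r = t := Subtype.ext (by simp [s, r])
    rw [← hsr, inner_unitVal_add, h1 n s rfl, zero_mul]
  · right
    push Not at h
    exact exists_exp_of_measurable_of_map_add_posReal (measurable_inner_unitVal u v) h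
      (inner_unitVal_add u v)

/-- Two multiplicative sections with the same inner products with the exponential units agree. -/
theorem eq_of_inner_constLp_eq {u v : ∀ t, FockSpace t}
    (hu : ∀ {s t r : PosReal} (h : s + t = r), fockMul h (u s) (u t) = u r)
    (hv : ∀ {s t r : PosReal} (h : s + t = r), fockMul h (v s) (v t) = v r)
    (huv : ∀ z t, inner ℂ (coherent (constLp z t)) (u t) = inner ℂ (coherent (constLp z t)) (v t))
    (t : PosReal) : u t = v t := by
  refine hasDenseSpan_coherent.ext_inner fun f => ?_
  have h1 := coherent_mem_closure (P := fun t => {x | inner ℂ x (u t) = inner ℂ x (v t)}) huv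
    (fun {s t r} h x hx y hy => by
      simp only [Set.mem_ofPred_eq] at hx hy ⊢
      rw [← hu h, ← hv h, inner_fockMul, inner_fockMul, hx, hy]) f
  have hcl : IsClosed {x : FockSpace t | inner ℂ x (u t) = inner ℂ x (v t)} :=
    isClosed_eq (by fun_prop) (by fun_prop)
  rw [hcl.closure_eq] at h1
  exact h1

/-- Infinitesimal Cauchy–Schwarz: dividing by `t²` and letting `t ↓ 0` gives `‖l‖² ≤ 0 * m`. -/
theorem eq_zero_of_norm_sq_le_mul {L : ℝ → ℂ} {N M : ℝ → ℝ} {l : ℂ} {m : ℝ}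
    (hL : HasDerivAt L l 0) (hL0 : L 0 = 0) (hN : HasDerivAt N 0 0) (hN0 : N 0 = 0)
    (hM : HasDerivAt M m 0) (hM0 : M 0 = 0) (h : ∀ t, 0 < t → ‖L t‖ ^ 2 ≤ N t * M t) : l = 0 := by
  have hle : nhdsWithin (0 : ℝ) (Set.Ioi 0) ≤ nhdsWithin 0 {0}ᶜ :=
    nhdsWithin_mono _ fun x hx => ne_of_gt hx
  have h1 := (hasDerivAt_iff_tendsto_slope.1 hL).mono_left hle
  have h2 := (hasDerivAt_iff_tendsto_slope.1 hN).mono_left hle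
  have h3 := (hasDerivAt_iff_tendsto_slope.1 hM).mono_left hle
  have h4 := le_of_tendsto_of_tendsto (h1.norm.pow 2) (h2.mul h3) (by
    filter_upwards [self_mem_nhdsWithin] with t ht
    have ht' : 0 < t := ht
    simp only [slope_def_module, sub_zero, hL0, hN0, hM0, norm_smul, norm_inv, Real.norm_eq_abs,
      abs_of_pos ht', smul_eq_mul]
    calc (t⁻¹ * ‖L t‖) ^ 2 = t⁻¹ ^ 2 * ‖L t‖ ^ 2 := by ring
      _ ≤ t⁻¹ ^ 2 * (N t * M t) := by gcongr; exact h t ht'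
      _ = t⁻¹ * N t * (t⁻¹ * M t) := by ring)
  rw [zero_mul] at h4
  have h5 : ‖l‖ = 0 := by nlinarith [norm_nonneg l]
  exact norm_eq_zero.1 h5

theorem exists_inner_self_unitVal (u : fockArveson.MulUnit) :
    ∃ κ : ℂ, ∀ t : PosReal, ‖unitVal u t‖ ^ 2 = (Complex.exp ((t : ℝ) * κ)).re := by
  obtain ⟨t₀, h0⟩ := u.nonzero
  rcases inner_unitVal_eq_zero_or_exp u u with h | ⟨κ, hκ⟩
  · exact absurd (inner_self_eq_zero.1 (h t₀)) h0
  · exact ⟨κ, fun t => by rw [← hκ, ← @inner_self_eq_norm_sq ℂ]; rfl⟩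

theorem hasDerivAt_exp_mul (γ : ℂ) :
    HasDerivAt (fun t : ℝ => Complex.exp (t * γ)) γ 0 := by
  have h1 : HasDerivAt (fun t : ℝ => (t : ℂ) * γ) γ 0 := by
    simpa using (hasDerivAt_id (0 : ℝ)).ofReal_comp.mul_const γ
  simpa using h1.cexp

theorem norm_sq_coherent_constLp_sub (z w : ℂ) (t : PosReal) :
    ‖coherent (constLp w t) - coherent (constLp z t)‖ ^ 2 =
      (Complex.exp ((t : ℝ) * (conj w * w)) - Complex.exp ((t : ℝ) * (conj w * z)) -
        (Complex.exp ((t : ℝ) * (conj z * w)) - Complex.exp ((t : ℝ) * (conj z * z)))).re := by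
  rw [← @inner_self_eq_norm_sq ℂ, inner_sub_left, inner_sub_right, inner_sub_right]
  simp only [inner_coherent_constLp]
  rfl

theorem exists_inner_coherent_constLp_unitVal (u : fockArveson.MulUnit) (w : ℂ) :
    ∃ γ : ℂ, ∀ t : PosReal,
      inner ℂ (coherent (constLp w t)) (unitVal u t) = Complex.exp ((t : ℝ) * γ) := by
  have hexp : ∀ z t, unitVal (expUnit 0 z) t = coherent (constLp z t) := fun z t => by
    rw [unitVal_expUnit, mul_zero, Complex.exp_zero, one_smul]
  have hdich : ∀ z, (∀ t, inner ℂ (coherent (constLp z t)) (unitVal u t) = 0) ∨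
      ∃ γ : ℂ, ∀ t : PosReal,
        inner ℂ (coherent (constLp z t)) (unitVal u t) = Complex.exp ((t : ℝ) * γ) := fun z => by
    simpa only [hexp] using inner_unitVal_eq_zero_or_exp (expUnit 0 z) u
  refine (hdich w).resolve_left fun hw => ?_
  -- Some `z` pairs nontrivially with `u`; otherwise `u` and the zero section would have the same
  -- inner products with all `Exp (z 1)`, and `u` would vanish.
  obtain ⟨z, γ, hγ⟩ : ∃ z, ∃ γ : ℂ, ∀ t : PosReal,
      inner ℂ (coherent (constLp z t)) (unitVal u t) = Complex.exp ((t : ℝ) * γ) := by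
    by_contra hno
    have h0 : ∀ z t, inner ℂ (coherent (constLp z t)) (unitVal u t) = 0 := fun z =>
      (hdich z).resolve_right fun h => hno ⟨z, h⟩
    obtain ⟨t₀, ht₀⟩ := u.nonzero
    exact ht₀ (eq_of_inner_constLp_eq (u := unitVal u) (v := fun _ => 0) (unitVal_mul u)
      (fun h => by simp) (fun z t => by rw [h0, inner_zero_right]) t₀)
  obtain ⟨κ, hκ⟩ := exists_inner_self_unitVal u
  -- Cauchy–Schwarz for `Exp (w 1) - Exp (z 1)` against `u`. As `t ↓ 0` the left side tends to 1 and
  -- the right side to 0, a contradiction.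
  have hle : ∀ t : ℝ, 0 < t → ‖Complex.exp (t * γ)‖ ^ 2 ≤
      (Complex.exp (t * (conj w * w)) - Complex.exp (t * (conj w * z)) -
        (Complex.exp (t * (conj z * w)) - Complex.exp (t * (conj z * z)))).re *
          (Complex.exp (t * κ)).re := by
    intro t ht
    have h1 := norm_inner_le_norm (𝕜 := ℂ)
      (coherent (constLp w ⟨t, ht⟩) - coherent (constLp z ⟨t, ht⟩)) (unitVal u ⟨t, ht⟩)
    rw [inner_sub_left, hw, hγ, zero_sub, norm_neg] at h1
    have h2 := pow_le_pow_left₀ (norm_nonneg _) h1 2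
    rw [mul_pow, norm_sq_coherent_constLp_sub, hκ] at h2
    exact h2
  have hc1 : Continuous fun t : ℝ => ‖Complex.exp (t * γ)‖ ^ 2 := by fun_prop
  have hc2 : Continuous fun t : ℝ =>
      (Complex.exp (t * (conj w * w)) - Complex.exp (t * (conj w * z)) -
        (Complex.exp (t * (conj z * w)) - Complex.exp (t * (conj z * z)))).re *
          (Complex.exp (t * κ)).re := by fun_prop
  have h3 := le_of_tendsto_of_tendsto ((hc1.tendsto 0).mono_left nhdsWithin_le_nhds)
    ((hc2.tendsto 0).mono_left nhdsWithin_le_nhds)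
    (Filter.eventually_of_mem (self_mem_nhdsWithin (s := Set.Ioi (0 : ℝ))) hle)
  norm_num at h3

/-- Every unit is of the form `t ↦ exp (t a) • Exp (b 1_{(0,t)})`. -/
theorem exists_unitVal_eq (u : fockArveson.MulUnit) :
    ∃ a b : ℂ, ∀ t : PosReal,
      unitVal u t = Complex.exp ((t : ℝ) * a) • coherent (constLp b t) := by
  choose γ hγ using exists_inner_coherent_constLp_unitVal u
  obtain ⟨κ, hκ⟩ := exists_inner_self_unitVal u
  have hlin : ∀ z, γ z - γ 0 - conj z * (γ 1 - γ 0) = 0 := by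
    intro z
    -- The coefficients satisfy `∑ c i = 0` and `∑ c i * p i = 0`. Hence `d` is orthogonal to the
    -- vacuum, and `N = ‖d‖²` has value 0 and derivative `|∑ c i * p i|² = 0` at time 0, while the
    -- derivative of `L` is the affine defect of `γ`.
    let c : Fin 3 → ℂ := ![1, z - 1, -z]
    let p : Fin 3 → ℂ := ![z, 0, 1]
    let d : ∀ t, FockSpace t := fun t => ∑ i, c i • coherent (constLp (p i) t)
    -- Removing the vacuum component of `u` leaves its inner product with `d` unchanged and makes `M
    -- = ‖w‖²` vanish at time 0.
    let w : ∀ t, FockSpace t := fun t =>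
      unitVal u t - Complex.exp ((t : ℝ) * γ 0) • coherent (constLp 0 t)
    let L : ℝ → ℂ := fun t => ∑ i, conj (c i) * Complex.exp (t * γ (p i))
    let N : ℝ → ℝ := fun t =>
      (∑ i, ∑ j, conj (c i) * c j * Complex.exp (t * (conj (p i) * p j))).re
    let M : ℝ → ℝ := fun t => (Complex.exp (t * κ)).re -
      (Complex.exp (t * (conj (γ 0) + γ 0))).re
    have hd0 : ∀ t, inner ℂ (d t) (coherent (constLp 0 t)) = 0 := by
      intro t
      simp only [d, sum_inner, inner_smul_left, inner_coherent_constLp]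
      simp [Fin.sum_univ_three, c]
    have hdw : ∀ t : PosReal, inner ℂ (d t) (w t) = L t := by
      intro t
      simp only [w, inner_sub_right, inner_smul_right, hd0, mul_zero, sub_zero]
      simp only [d, L, sum_inner, inner_smul_left, hγ]
    have hdN : ∀ t : PosReal, ‖d t‖ ^ 2 = N t := by
      intro t
      rw [← @inner_self_eq_norm_sq ℂ]
      simp only [d, N, sum_inner, inner_sum, inner_smul_left, inner_smul_right,
        inner_coherent_constLp, Finset.mul_sum]
      rw [Finset.sum_comm]
      refine congrArg Complex.re
        (Finset.sum_congr rfl fun i _ => Finset.sum_congr rfl fun j _ => ?_)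
      ring
    have hwM : ∀ t : PosReal, ‖w t‖ ^ 2 = M t := by
      intro t
      have h0 : inner ℂ (coherent (constLp 0 t)) (coherent (constLp 0 t)) = (1 : ℂ) := by
        rw [inner_coherent_constLp]; simp
      have h1 : inner ℂ (unitVal u t) (coherent (constLp 0 t)) =
          conj (Complex.exp ((t : ℝ) * γ 0)) := by rw [← hγ, inner_conj_symm]
      have h2 : conj (Complex.exp ((t : ℝ) * γ 0)) * Complex.exp ((t : ℝ) * γ 0) =
          Complex.exp ((t : ℝ) * (conj (γ 0) + γ 0)) := by
        rw [← Complex.exp_conj, ← Complex.exp_add, map_mul, Complex.conj_ofReal, mul_add]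
      have h3 : inner ℂ (w t) (w t) = inner ℂ (unitVal u t) (unitVal u t) -
          Complex.exp ((t : ℝ) * (conj (γ 0) + γ 0)) := by
        simp only [w, inner_sub_left, inner_sub_right, inner_smul_left, inner_smul_right, h0, h1,
          hγ, ← h2]
        ring
      rw [← @inner_self_eq_norm_sq ℂ, h3, map_sub, inner_self_eq_norm_sq, hκ]
      rfl
    have hL : HasDerivAt L (γ z - γ 0 - conj z * (γ 1 - γ 0)) 0 := by
      have h1 := HasDerivAt.fun_sum (u := Finset.univ) fun i (_ : i ∈ Finset.univ) =>
        (hasDerivAt_exp_mul (γ (p i))).const_mul (conj (c i))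
      refine h1.congr_deriv ?_
      simp [Fin.sum_univ_three, c, p]
      ring
    have hN : HasDerivAt N 0 0 := by
      have h1 := HasDerivAt.fun_sum (u := Finset.univ) fun i (_ : i ∈ Finset.univ) =>
        HasDerivAt.fun_sum (u := Finset.univ) fun j (_ : j ∈ Finset.univ) =>
          (hasDerivAt_exp_mul (conj (p i) * p j)).const_mul (conj (c i) * c j)
      have h2 := Complex.reCLM.hasFDerivAt.comp_hasDerivAt (0 : ℝ) h1
      refine h2.congr_deriv ?_
      simp [Fin.sum_univ_three, c, p]
    have hM : HasDerivAt M (κ.re - (conj (γ 0) + γ 0).re) 0 :=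
      (Complex.reCLM.hasFDerivAt.comp_hasDerivAt (0 : ℝ) (hasDerivAt_exp_mul κ)).sub
        (Complex.reCLM.hasFDerivAt.comp_hasDerivAt (0 : ℝ) (hasDerivAt_exp_mul (conj (γ 0) + γ 0)))
    refine eq_zero_of_norm_sq_le_mul hL ?_ hN ?_ hM ?_ ?_
    · simp [L, Fin.sum_univ_three, c]
    · simp [N, Fin.sum_univ_three, c]
      ring
    · simp [M]
    · intro t ht
      have h1 := norm_inner_le_norm (𝕜 := ℂ) (d ⟨t, ht⟩) (w ⟨t, ht⟩)
      rw [hdw] at h1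
      have h2 := pow_le_pow_left₀ (norm_nonneg _) h1 2
      rwa [mul_pow, hdN, hwM] at h2
  refine ⟨γ 0, γ 1 - γ 0, eq_of_inner_constLp_eq (unitVal_mul u)
    (fun h => unitVal_mul (expUnit (γ 0) (γ 1 - γ 0)) h) fun z t => ?_⟩
  rw [hγ, inner_smul_right, inner_coherent_constLp, ← Complex.exp_add, ← mul_add]
  congr 2
  linear_combination hlin z

theorem inner_exp_smul_coherent (a b a' b' : ℂ) (t : PosReal) :
    inner ℂ (Complex.exp ((t : ℝ) * a) • coherent (constLp b t))
      (Complex.exp ((t : ℝ) * a') • coherent (constLp b' t)) =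
      Complex.exp ((t : ℝ) * (conj a + a' + conj b * b')) := by
  rw [inner_smul_left, inner_smul_right, inner_coherent_constLp, ← Complex.exp_conj,
    ← Complex.exp_add, ← Complex.exp_add, map_mul, Complex.conj_ofReal]
  congr 1
  ring

/-- The quotient by the null vectors is one-dimensional for a kernel of the form
`conj (a u) + a v + conj (b u) * b v` with nonconstant `b`. -/
theorem rank_range_covarianceMap {X : Type} (a b : X → ℂ) {x y : X} (hxy : b x ≠ b y) :
    Module.rank ℂ (LinearMap.range (ArvesonSystem.covarianceMap
      fun u v => conj (a u) + a v + conj (b u) * b v)) = 1 := by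
  let B : (X →₀ ℂ) →ₗ[ℂ] ℂ := Finsupp.linearCombination ℂ b
  let ψ : ArvesonSystem.sumZero X → ℂ := fun f => conj (B f)
  have hsum : ∀ f : ArvesonSystem.sumZero X, (f : X →₀ ℂ).sum (fun _ r => r) = 0 := by
    intro f
    have h1 := LinearMap.mem_ker.1 f.2
    simpa [Finsupp.linearCombination_apply] using h1
  have hinner : ∀ (f : ArvesonSystem.sumZero X) (v : X), ((f : X →₀ ℂ).sum fun u r =>
      conj r * (conj (a u) + a v + conj (b u) * b v)) =
      ((f : X →₀ ℂ).sum fun u r => conj r * conj (a u)) + conj (B f) * b v := by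
    intro f v
    have h1 : conj ((f : X →₀ ℂ).sum fun _ r => r) = 0 := by rw [hsum, map_zero]
    simp only [Finsupp.sum, map_sum] at h1
    simp only [B, Finsupp.linearCombination_apply, Finsupp.sum, map_sum, smul_eq_mul, map_mul,
      Finset.sum_mul, mul_add, Finset.sum_add_distrib]
    rw [← Finset.sum_mul, h1, zero_mul, add_zero]
    simp only [mul_assoc]
  -- On functions of sum zero the terms depending on only one of `u`, `v` drop out; the form that
  -- remains is `conj (B f) * B g`.
  have hmap : ∀ g : ArvesonSystem.sumZero X, ArvesonSystem.covarianceMap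
      (fun u v => conj (a u) + a v + conj (b u) * b v) g = B g • ψ := by
    intro g
    funext f
    simp only [ArvesonSystem.covarianceMap, LinearMap.pi_apply, LinearMap.comp_apply,
      Submodule.subtype_apply, hinner, Finsupp.linearCombination_apply, smul_eq_mul, Pi.smul_apply]
    have h1 := hsum g
    simp only [Finsupp.sum] at h1
    simp only [ψ, B, Finsupp.linearCombination_apply, Finsupp.sum, smul_eq_mul, mul_add,
      Finset.sum_add_distrib]
    rw [← Finset.sum_mul, h1, zero_mul, zero_add, Finset.sum_mul]
    exact Finset.sum_congr rfl fun _ _ => by ring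
  let g₀ : ArvesonSystem.sumZero X := ⟨Finsupp.single x 1 - Finsupp.single y 1, by
    rw [ArvesonSystem.sumZero, LinearMap.mem_ker]
    simp⟩
  have hg₀ : B g₀ = b x - b y := by simp [B, g₀]
  have hB : B g₀ ≠ 0 := by rw [hg₀]; exact sub_ne_zero.2 hxy
  have hψ : ψ ≠ 0 := fun h => hB (by
    have := congrFun h g₀
    simpa [ψ] using this)
  have hrange : LinearMap.range (ArvesonSystem.covarianceMap
      fun u v => conj (a u) + a v + conj (b u) * b v) = ℂ ∙ ψ := by
    apply le_antisymm
    · rintro _ ⟨g, rfl⟩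
      rw [hmap]
      exact Submodule.smul_mem _ _ (Submodule.mem_span_singleton_self ψ)
    · rw [Submodule.span_singleton_le_iff_mem]
      refine ⟨(B g₀)⁻¹ • g₀, ?_⟩
      rw [map_smul, hmap, smul_smul, inv_mul_cancel₀ hB, one_smul]
  rw [hrange, ← Module.finrank_eq_rank, finrank_span_singleton hψ, Nat.cast_one]

theorem hasIndex_fockArveson : fockArveson.HasIndex 1 := by
  choose a b hab using exists_unitVal_eq
  refine ⟨fun u v => conj (a u) + a v + conj (b u) * b v, fun u v t => ?_, ?_⟩
  · have h1 := inner_exp_smul_coherent (a u) (b u) (a v) (b v) t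
    rw [← hab, ← hab] at h1
    exact h1
  · rw [Nat.cast_one]
    refine rank_range_covarianceMap a b (x := expUnit 0 0) (y := expUnit 0 1) fun h => ?_
    have h0 := hab (expUnit 0 0) PosReal.one
    have h1 := hab (expUnit 0 1) PosReal.one
    rw [← h] at h1
    set e := coherent (constLp (b (expUnit 0 0)) PosReal.one)
    have hne : ∀ c : ℂ, Complex.exp (((PosReal.one : PosReal) : ℝ) * c) ≠ 0 := fun c =>
      Complex.exp_ne_zero _
    -- If `b` agreed on the two units, `Exp 1` would be a multiple `k` of the vacuum. Pairing with
    -- the vacuum gives `k = 1`, and then `‖Exp 1‖² = e` would equal 1.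
    obtain ⟨k, hk⟩ : ∃ k : ℂ, coherent (constLp 1 PosReal.one) =
        k • coherent (constLp 0 PosReal.one) := by
      rw [unitVal_expUnit, mul_zero, Complex.exp_zero, one_smul] at h0 h1
      refine ⟨Complex.exp ((PosReal.one : ℝ) * a (expUnit 0 1)) *
        (Complex.exp ((PosReal.one : ℝ) * a (expUnit 0 0)))⁻¹, ?_⟩
      rw [h0, h1, smul_smul, mul_assoc, inv_mul_cancel₀ (hne _), mul_one]
    have h2 := inner_coherent_constLp 0 1 PosReal.one
    have h3 := inner_coherent_constLp 1 1 PosReal.one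
    have h4 := inner_coherent_constLp 1 0 PosReal.one
    have h5 := inner_coherent_constLp 0 0 PosReal.one
    rw [hk, inner_smul_right, h5] at h2
    nth_rewrite 2 [hk] at h3
    rw [inner_smul_right, h4] at h3
    simp only [map_zero, mul_zero, Complex.exp_zero, mul_one, map_one, PosReal.one,
      Complex.ofReal_one] at h2 h3
    rw [h2] at h3
    have h6 : Real.exp 1 = 1 := by
      have := congrArg Complex.re h3
      rw [Complex.one_re, ← Complex.ofReal_one, Complex.exp_ofReal_re] at this
      exact this.symm
    linarith [Real.add_one_lt_exp (one_ne_zero (α := ℝ))]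

/-! ### Representations -/

/-- A nonzero Gram determinant makes `x`, `y` a basis of the plane, by Cramer's rule. The linear map
prescribed on it preserves inner products, as these are determined by the Gram matrix. -/
theorem exists_linearIsometry_of_gram {E H : Type*} [NormedAddCommGroup E] [InnerProductSpace ℂ E]
    [NormedAddCommGroup H] [InnerProductSpace ℂ H] (hE : Module.finrank ℂ E = 2) {x y : E} {p q : H}
    (hdet : (inner ℂ x x * inner ℂ y y : ℂ) ≠ inner ℂ x y * inner ℂ y x)
    (hpp : (inner ℂ p p : ℂ) = inner ℂ x x) (hpq : (inner ℂ p q : ℂ) = inner ℂ x y)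
    (hqq : (inner ℂ q q : ℂ) = inner ℂ y y) :
    Submodule.span ℂ {x, y} = ⊤ ∧ ∃ α : E →ₗᵢ[ℂ] H, α x = p ∧ α y = q := by
  have hli : LinearIndependent ℂ ![x, y] := by
    refine LinearIndependent.pair_iff.2 fun s r h => ?_
    have h1 : s * inner ℂ x x + r * inner ℂ x y = (0 : ℂ) := by
      rw [← inner_smul_right, ← inner_smul_right, ← inner_add_right, h, inner_zero_right]
    have h2 : s * inner ℂ y x + r * inner ℂ y y = (0 : ℂ) := by
      rw [← inner_smul_right, ← inner_smul_right, ← inner_add_right, h, inner_zero_right]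
    have hd := sub_ne_zero.2 hdet
    constructor
    · refine (mul_eq_zero.1 ?_).resolve_right hd
      linear_combination inner ℂ y y * h1 - inner ℂ x y * h2
    · refine (mul_eq_zero.1 ?_).resolve_right hd
      linear_combination inner ℂ x x * h2 - inner ℂ y x * h1
  have hspan : Submodule.span ℂ (Set.range ![x, y]) = ⊤ :=
    hli.span_eq_top_of_card_eq_finrank (by rw [hE, Fintype.card_fin])
  have hqp : (inner ℂ q p : ℂ) = inner ℂ y x := by
    rw [← inner_conj_symm, hpq, inner_conj_symm]
  have hgram : ∀ i j, (inner ℂ (![p, q] i) (![p, q] j) : ℂ) = inner ℂ (![x, y] i) (![x, y] j) := by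
    intro i j
    fin_cases i <;> fin_cases j
    exacts [hpp, hpq, hqp, hqq]
  let b := Module.Basis.mk hli hspan.ge
  have hb : ∀ i, b.constr ℂ ![p, q] (![x, y] i) = ![p, q] i := fun i => by
    have := b.constr_basis ℂ ![p, q] i
    rwa [Module.Basis.mk_apply] at this
  have hmem : ∀ z : E, z ∈ Submodule.span ℂ (Set.range ![x, y]) := fun z => by
    rw [hspan]; trivial
  have hinner : ∀ z z', (inner ℂ (b.constr ℂ ![p, q] z) (b.constr ℂ ![p, q] z') : ℂ) =
      inner ℂ z z' := by
    intro z z'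
    have hz := hmem z
    induction hz using Submodule.span_induction with
    | mem z hz =>
      obtain ⟨i, rfl⟩ := hz
      have hz' := hmem z'
      induction hz' using Submodule.span_induction with
      | mem z' hz' => obtain ⟨j, rfl⟩ := hz'; rw [hb, hb, hgram]
      | zero => rw [map_zero, inner_zero_right, inner_zero_right]
      | add z₁ z₂ _ _ h₁ h₂ => rw [map_add, inner_add_right, h₁, h₂, inner_add_right]
      | smul k z₁ _ h₁ => rw [map_smul, inner_smul_right, h₁, inner_smul_right]
    | zero => rw [map_zero, inner_zero_left, inner_zero_left]
    | add z₁ z₂ _ _ h₁ h₂ => rw [map_add, inner_add_left, h₁, h₂, inner_add_left]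
    | smul k z₁ _ h₁ => rw [map_smul, inner_smul_left, h₁, inner_smul_left]
  refine ⟨?_, (b.constr ℂ ![p, q]).isometryOfInner hinner, hb 0, hb 1⟩
  rw [← hspan]
  rw [Matrix.range_cons, Matrix.range_cons, Matrix.range_empty, Set.union_empty,
    Set.singleton_union]

/-- Vectors in the Fock spaces with the Gram matrices of `x` and `y` that multiply like `x` and `y`
define a representation. -/
theorem exists_representation_of_gram (S : RationalSubproductSystem.{w}) {x y : ∀ t, S.E t}
    {p q : ∀ t : PosRat, FockSpace t.toReal}
    (hdet : ∀ t, (inner ℂ (x t) (x t) * inner ℂ (y t) (y t) : ℂ) ≠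
      inner ℂ (x t) (y t) * inner ℂ (y t) (x t))
    (hpp : ∀ t, (inner ℂ (p t) (p t) : ℂ) = inner ℂ (x t) (x t))
    (hpq : ∀ t, (inner ℂ (p t) (q t) : ℂ) = inner ℂ (x t) (y t))
    (hqq : ∀ t, (inner ℂ (q t) (q t) : ℂ) = inner ℂ (y t) (y t))
    (hcomm : ∀ α : ∀ t, S.E t →ₗᵢ[ℂ] FockSpace t.toReal, (∀ t, α t (x t) = p t) →
      (∀ t, α t (y t) = q t) → ∀ {s t u : PosRat} (h : s + t = u),
      fockSplit (PosRat.toReal_add h) (p u) =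
        ((TensorProduct.mapIsometry (α s) (α t) (S.β h (x u)) :
          FockSpace s.toReal ⊗[ℂ] FockSpace t.toReal) :
          UniformSpace.Completion (FockSpace s.toReal ⊗[ℂ] FockSpace t.toReal)) ∧
      fockSplit (PosRat.toReal_add h) (q u) =
        ((TensorProduct.mapIsometry (α s) (α t) (S.β h (y u)) :
          FockSpace s.toReal ⊗[ℂ] FockSpace t.toReal) :
          UniformSpace.Completion (FockSpace s.toReal ⊗[ℂ] FockSpace t.toReal))) :
    ∃ R : SubproductRepresentation S fockArveson,
      ∀ t, R.α t (x t) = p t ∧ R.α t (y t) = q t := by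
  choose hspan α hα using fun t => exists_linearIsometry_of_gram (S.finrank_eq_two t) (hdet t)
    (hpp t) (hpq t) (hqq t)
  refine ⟨⟨α, fun {s t u} h z => ?_⟩, hα⟩
  have hc := hcomm α (fun t => (hα t).1) (fun t => (hα t).2) h
  rw [← (hα u).1, ← (hα u).2] at hc
  -- Both sides of the intertwining relation are linear in `z`, so the two spanning vectors suffice.
  have hz : z ∈ Submodule.span ℂ {x u, y u} := by rw [hspan u]; trivial
  change fockSplit (PosRat.toReal_add h) (α u z) =
        ((TensorProduct.mapIsometry (α s) (α t) (S.β h z) :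
          FockSpace s.toReal ⊗[ℂ] FockSpace t.toReal) :
          UniformSpace.Completion (FockSpace s.toReal ⊗[ℂ] FockSpace t.toReal))
  induction hz using Submodule.span_induction with
  | mem z hz =>
    rcases hz with rfl | rfl
    · exact hc.1
    · exact hc.2
  | zero => simp only [map_zero, UniformSpace.Completion.coe_zero]
  | add z₁ z₂ _ _ h₁ h₂ => simp only [map_add, UniformSpace.Completion.coe_add, h₁, h₂]
  | smul k z₁ _ h₁ => simp only [map_smul, UniformSpace.Completion.coe_smul, h₁]

theorem fockSplit_unitVal (u : fockArveson.MulUnit) {s t r : PosReal} (h : s + t = r) :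
    fockSplit h (unitVal u r) = completionTmul (unitVal u s) (unitVal u t) := by
  rw [← unitVal_mul u h, fockMul_apply, LinearIsometryEquiv.apply_symm_apply]

theorem inner_unitVal_expUnit (a b a' b' : ℂ) (t : PosReal) :
    inner ℂ (unitVal (expUnit a b) t) (unitVal (expUnit a' b') t) =
      Complex.exp ((t : ℝ) * (conj a + a' + conj b * b')) :=
  inner_exp_smul_coherent a b a' b' t

theorem norm_eq_one_of_inner_self {H : Type*} [NormedAddCommGroup H] [InnerProductSpace ℂ H]
    {x : H} (h : (inner ℂ x x : ℂ) = 1) : ‖x‖ = 1 := by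
  have h1 := inner_self_eq_norm_sq (𝕜 := ℂ) x
  rw [h, RCLike.one_re] at h1
  exact (pow_eq_one_iff_of_nonneg (norm_nonneg x) two_ne_zero).1 h1.symm

theorem inner_self_of_norm_eq_one {H : Type*} [NormedAddCommGroup H] [InnerProductSpace ℂ H]
    {x : H} (h : ‖x‖ = 1) : (inner ℂ x x : ℂ) = 1 := by
  rw [inner_self_eq_norm_sq_to_K, h]; simp

theorem exists_representation_of_isForm1 (S : RationalSubproductSystem.{w}) (a : ℝ)
    (x y : ∀ t, S.E t) (h : S.IsForm1 a x y) :
    ∃ (R : SubproductRepresentation S fockArveson) (u v : fockArveson.MulUnit),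
      (∀ t, ‖u.val t‖ = 1) ∧ (∀ t, ‖v.val t‖ = 1) ∧
      (∀ t : PosReal, inner ℂ (u.val t) (v.val t) = ((a ^ (t : ℝ) : ℝ) : ℂ)) ∧
      ∀ t : PosRat, R.α t (x t) = u.val t.toReal ∧ R.α t (y t) = v.val t.toReal := by
  have ha := h.a_pos
  have hlog : Real.log a < 0 := Real.log_neg ha h.a_lt_one
  -- The unit `exp (t ln a) • Exp (l 1)` has squared norm `exp (t (2 ln a + l²))`, so this `l`
  -- normalizes it; its pairing with the vacuum is `exp (t ln a) = a^t` for any `l`.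
  set l : ℝ := Real.sqrt (-2 * Real.log a) with hl
  have hl2 : l * l = -2 * Real.log a := Real.mul_self_sqrt (by linarith)
  let u := expUnit 0 0
  let v := expUnit (Real.log a : ℂ) (l : ℂ)
  have huu : ∀ t, inner ℂ (unitVal u t) (unitVal u t) = (1 : ℂ) := fun t => by
    rw [inner_unitVal_expUnit]; simp
  have hvv : ∀ t, inner ℂ (unitVal v t) (unitVal v t) = (1 : ℂ) := fun t => by
    have h1 : ((Real.log a : ℂ) + Real.log a + l * l) = 0 := by
      have : Real.log a + Real.log a + l * l = 0 := by rw [hl2]; ring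
      exact_mod_cast this
    rw [inner_unitVal_expUnit, Complex.conj_ofReal, Complex.conj_ofReal, h1, mul_zero,
      Complex.exp_zero]
  have huv : ∀ t : PosReal, inner ℂ (unitVal u t) (unitVal v t) = ((a ^ (t : ℝ) : ℝ) : ℂ) :=
    fun t => by
      rw [inner_unitVal_expUnit, Real.rpow_def_of_pos ha, map_zero, zero_mul, zero_add, add_zero,
        mul_comm]
      push_cast
      rfl
  obtain ⟨R, hR⟩ := exists_representation_of_gram S (x := x) (y := y)
    (p := fun t => unitVal u t.toReal) (q := fun t => unitVal v t.toReal)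
    -- The Gram determinant is `1 - a^{2t}`, nonzero because `0 < a^t < 1`.
    (fun t => by
      have ht : (0 : ℝ) < ((t : ℚ) : ℝ) := by exact_mod_cast t.2
      have h1 : a ^ ((t : ℚ) : ℝ) < 1 := Real.rpow_lt_one ha.le h.a_lt_one ht
      have h2 : 0 < a ^ ((t : ℚ) : ℝ) := Real.rpow_pos_of_pos ha _
      rw [inner_self_of_norm_eq_one (h.norm_x t), inner_self_of_norm_eq_one (h.norm_y t),
        ← inner_conj_symm (y t), h.inner_xy, Complex.conj_ofReal, ← Complex.ofReal_mul, one_mul]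
      intro h3
      have h4 : (1 : ℝ) = a ^ ((t : ℚ) : ℝ) * a ^ ((t : ℚ) : ℝ) := by exact_mod_cast h3
      nlinarith)
    (fun t => by rw [huu, inner_self_of_norm_eq_one (h.norm_x t)])
    (fun t => by rw [huv, h.inner_xy]; rfl)
    (fun t => by rw [hvv, inner_self_of_norm_eq_one (h.norm_y t)])
    (fun α hαx hαy {s t r} hr => by
      rw [h.β_x, h.β_y, TensorProduct.mapIsometry_apply, TensorProduct.mapIsometry_apply,
        TensorProduct.map_tmul, TensorProduct.map_tmul]
      simp only [LinearIsometry.coe_toLinearMap, hαx, hαy]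
      exact ⟨fockSplit_unitVal u _, fockSplit_unitVal v _⟩)
  exact ⟨R, u, v, fun t => norm_eq_one_of_inner_self (huu t),
    fun t => norm_eq_one_of_inner_self (hvv t), huv, hR⟩

/-! ### One-particle vectors -/

/-- The one-particle vector `0 ⊕ f ⊕ 0 ⊕ ⋯`. -/
def oneParticle {t : PosReal} (f : Lp ℂ 2 (timeMeasure t)) : FockSpace t :=
  (lp.single 2 1 (tensorPow f 1) : Fock t)

theorem inner_fockExp_single {t : PosReal} (h f : Lp ℂ 2 (timeMeasure t)) :
    inner ℂ (fockExp h) (lp.single 2 1 (tensorPow f 1) : Fock t) = inner ℂ h f := by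
  rw [lp.inner_single_right, fockExp_apply, inner_smul_left_symL2, inner_tensorPow]
  simp

theorem inner_coherent_oneParticle {t : PosReal} (h f : Lp ℂ 2 (timeMeasure t)) :
    inner ℂ (coherent h) (oneParticle f) = inner ℂ h f := inner_fockExp_single h f

theorem inner_single_single {t : PosReal} (h f : Lp ℂ 2 (timeMeasure t)) :
    inner ℂ (lp.single 2 1 (tensorPow h 1) : Fock t) (lp.single 2 1 (tensorPow f 1) : Fock t) =
      inner ℂ h f := by
  rw [lp.inner_single_right, lp.single_apply_self, inner_tensorPow, pow_one]

theorem inner_oneParticle {t : PosReal} (h f : Lp ℂ 2 (timeMeasure t)) :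
    inner ℂ (oneParticle h) (oneParticle f) = inner ℂ h f := inner_single_single h f

theorem oneParticle_smul {t : PosReal} (k : ℂ) (f : Lp ℂ 2 (timeMeasure t)) :
    oneParticle (k • f) = k • oneParticle f :=
  hasDenseSpan_coherent.ext_inner fun h => by
    rw [inner_smul_right, inner_coherent_oneParticle, inner_coherent_oneParticle, inner_smul_right]

/-- Tested against products of exponential vectors: a one-particle vector pairs to `⟨l, k⟩`, which
is additive under concatenation, and each vacuum factor contributes `exp 0 = 1`. -/
theorem fockSplit_oneParticle {s t u : PosReal} (h : s + t = u) {f : Lp ℂ 2 (timeMeasure s)}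
    {g : Lp ℂ 2 (timeMeasure t)} {k : Lp ℂ 2 (timeMeasure u)} (hk : IsConcat f g k) :
    fockSplit h (oneParticle k) = completionTmul (oneParticle f) (coherent 0) +
      completionTmul (coherent 0) (oneParticle g) := by
  refine (hasDenseSpan_coherent_tmul h).ext_inner fun l => ?_
  have hl := isConcat_leftPart_rightPart h l
  rw [← fockSplit_coherent h hl, LinearIsometryEquiv.inner_map_map, fockSplit_coherent h hl,
    inner_add_right, inner_completionTmul, inner_completionTmul, inner_coherent_oneParticle,
    inner_coherent_oneParticle, inner_coherent_oneParticle, inner_coherent, inner_coherent,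
    inner_zero_right, inner_zero_right, Complex.exp_zero, mul_one, one_mul, hl.inner_eq h hk]

theorem isVacuum_fockExp_zero (t : PosReal) : IsVacuum (fockExp (0 : Lp ℂ 2 (timeMeasure t))) := by
  constructor
  · have h1 : fockExp (0 : Lp ℂ 2 (timeMeasure t)) 0 = tensorPow 0 0 := by
      rw [fockExp_apply]; simp
    rw [h1]
    filter_upwards [(memLp_tensorPow (Lp.memLp (0 : Lp ℂ 2 (timeMeasure t))) 0).coeFn_toLp] with ω h
    exact h.trans (by simp)
  · intro n hn
    have h1 := norm_tensorPow (0 : Lp ℂ 2 (timeMeasure t)) n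
    rw [norm_zero, zero_pow two_ne_zero, zero_pow hn] at h1
    have h2 : tensorPow (0 : Lp ℂ 2 (timeMeasure t)) n = 0 := by simpa using h1
    rw [fockExp_apply, h2, smul_zero]

theorem isOneParticle_single {t : PosReal} {f : Lp ℂ 2 (timeMeasure t)} {g : ℝ → ℂ}
    (hfg : ∀ᵐ r ∂timeMeasure t, f r = g r) :
    IsOneParticle (lp.single 2 1 (tensorPow f 1) : Fock t) g := by
  constructor
  · rw [lp.single_apply_self]
    have h2 : ∀ᵐ ω ∂timeMeasurePi t 1, f (ω 0) = g (ω 0) :=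
      (Measure.quasiMeasurePreserving_eval (fun _ : Fin 1 => timeMeasure t) 0).ae hfg
    filter_upwards [(memLp_tensorPow (Lp.memLp f) 1).coeFn_toLp, h2] with ω h3 h4
    exact h3.trans (by rw [Fin.prod_univ_one, h4])
  · intro n hn
    exact lp.single_apply_ne 2 1 _ hn

/-! ### The one-particle functions of form (3) -/

/-- The function `s ↦ A c^s e^{ibs}`. -/
def powFun (c b : ℝ) (s : ℝ) : ℂ :=
  (normConst c : ℂ) * ((c ^ s : ℝ) : ℂ) * Complex.exp (Complex.I * b * s)

/-- Translation by `s` multiplies the function by `c^s e^{ibs}`, the factor in the multiplication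
rule of form (3). -/
theorem powFun_add {c : ℝ} (hc : 0 < c) (b s r : ℝ) : powFun c b (s + r) =
    ((c ^ s : ℝ) : ℂ) * Complex.exp (Complex.I * b * s) * powFun c b r := by
  have h1 : Complex.exp (Complex.I * b * ((s + r : ℝ) : ℂ)) =
      Complex.exp (Complex.I * b * s) * Complex.exp (Complex.I * b * r) := by
    rw [← Complex.exp_add]; congr 1; push_cast; ring
  rw [powFun, powFun, Real.rpow_add hc, h1]
  push_cast
  ring

theorem continuous_powFun {c : ℝ} (hc : 0 < c) (b : ℝ) : Continuous (powFun c b) := by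
  have h1 : Continuous fun s : ℝ => c ^ s := Real.continuous_const_rpow hc.ne'
  unfold powFun
  fun_prop

theorem memLp_powFun {c : ℝ} (hc : 0 < c) (b : ℝ) (t : PosReal) :
    MemLp (powFun c b) 2 (timeMeasure t) := by
  have h1 := continuous_powFun hc b
  rw [memLp_two_iff_integrable_sq_norm h1.aestronglyMeasurable]
  exact ((h1.norm.pow 2).continuousOn.integrableOn_Icc (a := 0) (b := (t : ℝ))).mono_set
    Set.Ioo_subset_Icc_self

theorem isConcat_powFun {c : ℝ} (hc : 0 < c) (b : ℝ) {s t u : PosReal} (h : s + t = u) :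
    IsConcat ((memLp_powFun hc b s).toLp _)
      ((((c ^ (s : ℝ) : ℝ) : ℂ) * Complex.exp (Complex.I * b * (s : ℝ))) •
        (memLp_powFun hc b t).toLp _)
      ((memLp_powFun hc b u).toLp _) := by
  constructor
  · filter_upwards [(memLp_powFun hc b s).coeFn_toLp,
      ae_mono (timeMeasure_le h) (memLp_powFun hc b u).coeFn_toLp] with r h1 h2
    rw [h1, h2]
  · filter_upwards [(memLp_powFun hc b t).coeFn_toLp,
      ae_of_ae_map (by fun_prop) (ae_mono (map_timeMeasure_le h)
        (memLp_powFun hc b u).coeFn_toLp),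
      Lp.coeFn_smul (((c ^ (s : ℝ) : ℝ) : ℂ) * Complex.exp (Complex.I * b * (s : ℝ)))
        ((memLp_powFun hc b t).toLp _)] with r h1 h2 h3
    rw [h2, h3, Pi.smul_apply, h1, powFun_add hc, smul_eq_mul]

theorem norm_powFun_sq {c : ℝ} (hc : 0 < c) (b s : ℝ) :
    ‖powFun c b s‖ ^ 2 = normConst c ^ 2 * Real.exp (2 * Real.log c * s) := by
  have h1 : ‖Complex.exp (Complex.I * b * s)‖ = 1 := by
    rw [Complex.norm_exp]; simp
  rw [powFun, norm_mul, norm_mul, h1, mul_one, Complex.norm_real, Complex.norm_real, mul_pow,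
    Real.norm_eq_abs, Real.norm_eq_abs, sq_abs, sq_abs, Real.rpow_def_of_pos hc, ← Real.exp_nat_mul]
  congr 2
  push_cast
  ring

theorem normConst_sq_mul {c : ℝ} (hc : 0 < c) (hc1 : c ≠ 1) :
    normConst c ^ 2 * (2 * Real.log c)⁻¹ = (c ^ 2 - 1)⁻¹ := by
  have hlog : Real.log c ≠ 0 := Real.log_ne_zero_of_pos_of_ne_one hc hc1
  -- For `c < 1` numerator and denominator are both negative, so the radicand is nonnegative on
  -- either side of 1.
  have hpos : 0 ≤ 2 * Real.log c / (c ^ 2 - 1) := by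
    rcases lt_or_gt_of_ne hc1 with h | h
    · exact div_nonneg_of_nonpos (by linarith [Real.log_neg hc h]) (by nlinarith)
    · exact div_nonneg (by linarith [Real.log_pos h]) (by nlinarith)
  rw [normConst, if_neg hc1, Real.sq_sqrt hpos]
  field_simp

/-- The integral of `A² c^{2s}` over `(0, t)` must equal the prescribed `‖y t‖²`; this is what fixes
the constant `A`. -/
theorem inner_powFun {c : ℝ} (hc : 0 < c) (b : ℝ) (t : PosReal) :
    inner ℂ ((memLp_powFun hc b t).toLp _) ((memLp_powFun hc b t).toLp _) =
      ((if c = 1 then (t : ℝ) else (c ^ (2 * (t : ℝ)) - 1) / (c ^ 2 - 1) : ℝ) : ℂ) := by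
  have h1 : inner ℂ ((memLp_powFun hc b t).toLp _) ((memLp_powFun hc b t).toLp _) =
      ∫ s, ((normConst c ^ 2 * Real.exp (2 * Real.log c * s) : ℝ) : ℂ) ∂timeMeasure t := by
    rw [L2.inner_def]
    refine integral_congr_ae ?_
    filter_upwards [(memLp_powFun hc b t).coeFn_toLp] with r h1
    rw [h1, inner_self_eq_norm_sq_to_K, ← norm_powFun_sq hc b]
    simp
  rw [h1, integral_timeMeasure, intervalIntegral.integral_ofReal]
  congr 1
  rw [intervalIntegral.integral_const_mul]
  split_ifs with h
  · simp [normConst, h]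
  · have hlog : Real.log c ≠ 0 := Real.log_ne_zero_of_pos_of_ne_one hc h
    rw [intervalIntegral.integral_comp_mul_left (fun s => Real.exp s) (by simpa using hlog),
      integral_exp, smul_eq_mul, ← mul_assoc, normConst_sq_mul hc h, mul_zero, Real.exp_zero,
      Real.rpow_def_of_pos hc, div_eq_inv_mul]
    congr 3
    ring

theorem normSq_form3_ne_zero {c : ℝ} (hc : 0 < c) (t : PosReal) :
    (if c = 1 then (t : ℝ) else (c ^ (2 * (t : ℝ)) - 1) / (c ^ 2 - 1)) ≠ 0 := by
  have ht := t.2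
  split_ifs with h
  · exact ht.ne'
  · have hlog : Real.log c ≠ 0 := Real.log_ne_zero_of_pos_of_ne_one hc h
    refine div_ne_zero (sub_ne_zero.2 fun h1 => ?_) (sub_ne_zero.2 fun h1 => ?_)
    · rw [Real.rpow_def_of_pos hc, Real.exp_eq_one_iff] at h1
      rcases mul_eq_zero.1 h1 with h2 | h2
      · exact hlog h2
      · linarith
    · exact h ((pow_eq_one_iff_of_nonneg hc.le two_ne_zero).1 h1)

theorem exists_representation_of_isForm3 (S : RationalSubproductSystem.{w}) (c b : ℝ)
    (x y : ∀ t, S.E t) (h : S.IsForm3 c b x y) :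
    ∃ R : SubproductRepresentation S fockArveson,
      ∀ t : PosRat, IsVacuum (fockIdentification.U t.toReal (R.α t (x t))) ∧
        IsOneParticle (fockIdentification.U t.toReal (R.α t (y t))) fun s : ℝ =>
          (normConst c : ℂ) * ((c ^ s : ℝ) : ℂ) * Complex.exp (Complex.I * b * s) := by
  have hc := h.c_pos
  let f : ∀ t : PosReal, Lp ℂ 2 (timeMeasure t) := fun t => (memLp_powFun hc b t).toLp _
  have hyy : ∀ t : PosRat, (inner ℂ (y t) (y t) : ℂ) = inner ℂ (f t.toReal) (f t.toReal) := by
    intro t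
    rw [inner_powFun hc, inner_self_eq_norm_sq_to_K]
    exact (Complex.ofReal_pow _ 2).symm.trans (congrArg Complex.ofReal (h.norm_y t))
  obtain ⟨R, hR⟩ := exists_representation_of_gram S (x := x) (y := y)
    (p := fun t => coherent (0 : Lp ℂ 2 (timeMeasure t.toReal)))
    (q := fun t => oneParticle (f t.toReal))
    (fun t => by
      rw [inner_self_of_norm_eq_one (h.norm_x t), hyy, h.inner_xy, zero_mul, one_mul,
        inner_powFun hc]
      exact_mod_cast normSq_form3_ne_zero hc t.toReal)
    (fun t => by
      rw [inner_coherent, inner_zero_right, Complex.exp_zero,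
        inner_self_of_norm_eq_one (h.norm_x t)])
    (fun t => by rw [inner_coherent_oneParticle, inner_zero_left, h.inner_xy])
    (fun t => by rw [inner_oneParticle, hyy])
    (fun α hαx hαy {s t r} hr => by
      rw [h.β_x, h.β_y, map_add, map_smul, TensorProduct.mapIsometry_apply,
        TensorProduct.mapIsometry_apply, TensorProduct.mapIsometry_apply, TensorProduct.map_tmul,
        TensorProduct.map_tmul, TensorProduct.map_tmul]
      simp only [LinearIsometry.coe_toLinearMap, hαx, hαy]
      constructor
      · refine fockSplit_coherent _ ?_
        -- The vacuum is the exponential of the constant function 0, so its splitting is a case of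
        -- constant functions.
        have h0 := isConcat_constLp 0 s.toReal t.toReal r.toReal (PosRat.toReal_add hr)
        simpa only [constLp, map_zero] using h0
      · have h1 := fockSplit_oneParticle (PosRat.toReal_add hr)
          (isConcat_powFun hc b (PosRat.toReal_add hr))
        rw [oneParticle_smul, map_smul] at h1
        rw [UniformSpace.Completion.coe_add, UniformSpace.Completion.coe_smul]
        exact h1)
  refine ⟨R, fun t => ?_⟩
  rw [(hR t).1, (hR t).2]
  exact ⟨isVacuum_fockExp_zero t.toReal, isOneParticle_single (memLp_powFun hc b t.toReal).coeFn_toLp⟩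

end

theorem mainTheorem6 :
    ∃ (A : ArvesonSystem) (F : FockIdentification A), A.IsTypeIn 1 ∧
      (∀ (S : RationalSubproductSystem.{w}) (a : ℝ) (x y : ∀ t, S.E t), S.IsForm1 a x y →
        ∃ (R : SubproductRepresentation S A) (u v : A.MulUnit),
          (∀ t, ‖u.val t‖ = 1) ∧ (∀ t, ‖v.val t‖ = 1) ∧
          (∀ t : PosReal, inner ℂ (u.val t) (v.val t) = ((a ^ (t : ℝ) : ℝ) : ℂ)) ∧
          ∀ t : PosRat, R.α t (x t) = u.val t.toReal ∧ R.α t (y t) = v.val t.toReal) ∧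
      (∀ (S : RationalSubproductSystem.{w}) (c b : ℝ) (x y : ∀ t, S.E t), S.IsForm3 c b x y →
        ∃ R : SubproductRepresentation S A,
          ∀ t : PosRat, IsVacuum (F.U t.toReal (R.α t (x t))) ∧
            IsOneParticle (F.U t.toReal (R.α t (y t))) fun s : ℝ =>
              (normConst c : ℂ) * ((c ^ s : ℝ) : ℂ) * Complex.exp (Complex.I * b * s)) :=
  ⟨fockArveson, fockIdentification, ⟨isTypeI_fockArveson, hasIndex_fockArveson⟩,
    exists_representation_of_isForm1, exists_representation_of_isForm3⟩
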